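/- Let $d\in\mathbb N$ and let $\mathcal H=L^2(\mathbb R^d)$ or $\mathcal H=\ell^2(\mathbb Z^d)$ (identified with $L^2(\mathbb R^d,\nu)$, $\nu$ the counting measure of $\mathbb Z^d$). Put $|x|=\max_i|x_i|$; for $x\in\mathbb Z^d$ let $\chi_x$ be multiplication by the characteristic function of the open box of side length $1$ centred at $x$; $\|A\|_2\in[0,\infty]$ denotes the Hilbert–Schmidt norm. Let $(H_\omega)_{\omega\in\Omega}$ be a $\mathbb Z^d$-ergodic random operator on $\mathcal H$: $(\Omega,\mathbb P)$ is a probability space with an ergodic measure-preserving action $(\tau_a)_{a\in\mathbb Z^d}$ of $\mathbb Z^d$, each $H_\omega$ is a (possibly unbounded) self-adjoint operator, $\omega\mapsto\langle\varphi,(H_\omega-z)^{-1}\psi\rangle$ is measurable for all $\varphi,\psi\in\mathcal H$ and $z\in\mathbb C\setminus\mathbb R$, and $H_{\tau_a\omega}=U_aH_\omega U_a^*$, where $(U_a\psi)(x)=\psi(x-a)$. Let $I\subset\mathbb R$ be an open interval such that, for almost every $\omega$, $I\subset\sigma(H_\omega)$ and $H_\omega$ has pure point spectrum in $I$ (that is,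 $\operatorname{Ran}\chi_I(H_\omega)$ is the closed span of the eigenvectors of $H_\omega$ with eigenvalues in $I$). In the case $\mathcal H=L^2(\mathbb R^d)$ assume also that the spectral projections are locally trace class in $I$, uniformly in $\omega$: for every compact interval $[a,b]\subset I$ there is $C<\infty$ with $\operatorname{tr}\{\chi_0\,\chi_{(a,b)}(H_\omega)\,\chi_0\}\le C$ for almost every $\omega$. (For $\ell^2(\mathbb Z^d)$ this holds automatically, with $C=1$.) Let $C^\infty_{c,+}(I)$ be the set of nonnegative smooth functions on $\mathbb R$ with compact support contained in $I$, let $P_{E,\omega}=\chi_{\{E\}}(H_\omega)$, and put $$M_{u,\omega}(\sigma,\zeta,\mathcal X,t)=\bigl\|e^{\frac\sigma2|X-u|^\zeta}e^{-itH_\omega}\mathcal X(H_\omega)\chi_u\bigr\|_2^2\in[0,\infty],$$ where $|X-u|$ is multiplication by the function $x\mapsto|x-u|$. The following properties are equivalent. (i) There exist $\sigma>0$, $\zeta\in(0,1]$ such that for all $u\in\mathbb Z^d$ and $\mathcal X\in C^\infty_{c,+}(I)$: $\displaystyle\sup_{T>0}\frac1T\int_0^T\mathbb E\{M_{u,\omega}(\sigma,\zeta,\mathcal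 X,t)\}\,dt<\infty$. (ii) There exist $\sigma>0$, $\zeta\in(0,1]$ such that for all $u\in\mathbb Z^d$ and $\mathcal X\in C^\infty_{c,+}(I)$: $\displaystyle\sup_{T>0}\frac1T\int_0^\infty e^{-t/T}\,\mathbb E\{M_{u,\omega}(\sigma,\zeta,\mathcal X,t)\}\,dt<\infty$. (iii) There exist $\sigma>0$, $\zeta\in(0,1]$ such that for all $u\in\mathbb Z^d$ and $\mathcal X\in C^\infty_{c,+}(I)$: $\displaystyle\mathbb E\Bigl(\sup_{t\in\mathbb R}M_{u,\omega}(\sigma,\zeta,\mathcal X,t)\Bigr)<\infty$. (iv) There exist $\zeta\in(0,1]$, $\sigma>0$ such that for every $\mathcal X\in C^\infty_{c,+}(I)$ there is a constant $C<\infty$ with $\displaystyle\mathbb E\Bigl(\sup_{t\in\mathbb R}\|\chi_xe^{-itH_\omega}\mathcal X(H_\omega)\chi_u\|_2\Bigr)\le C\,e^{-\sigma|x-u|^\zeta}$ for all $x,u\in\mathbb Z^d$. (v) There exist $\zeta\in(0,1]$, $\sigma>0$ such that for every $\mathcal X\in C^\infty_{c,+}(I)$ there is a constant $C<\infty$ with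 $\displaystyle\mathbb E\Bigl(\sup_{E\in\mathbb R}\mathcal X(E)\,\|\chi_xP_{E,\omega}\chi_u\|_2\Bigr)\le C\,e^{-\sigma|x-u|^\zeta}$ for all $x,u\in\mathbb Z^d$. If one of these properties holds, $H_\omega$ is said to exhibit strong dynamical localization in $I$. -/

import Mathlib

open MeasureTheory Set
open scoped ENNReal NNReal InnerProductSpace

noncomputable section

namespace RandomOp

/-! ### Unbounded self-adjoint operators on a Hilbert space -/

section Abstract

variable {E : Type*} [NormedAddCommGroup E] [InnerProductSpace ℂ E] [CompleteSpace E]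

/-- `R` is a bounded two-sided inverse of `H - z : dom H → E`. -/
def IsResolventAt (H : E →ₗ.[ℂ] E) (z : ℂ) (R : E →L[ℂ] E) : Prop :=
  (∀ η : E, ∃ h : R η ∈ H.domain, H ⟨R η, h⟩ - z • R η = η) ∧
    ∀ ψ : H.domain, R (H ψ - z • (ψ : E)) = ψ

/-- The real part of the spectrum of `H` (all of it if `H` is self-adjoint): the real `x` for
which `H - x` has no bounded inverse. -/
def realSpectrum (H : E →ₗ.[ℂ] E) : Set ℝ :=
  {x | ¬ ∃ R : E →L[ℂ] E, IsResolventAt H (x : ℂ) R}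

open Classical in
/-- The resolvent `(H - z)⁻¹` (and `0` if `z` is in the spectrum). -/
def resolventOp (H : E →ₗ.[ℂ] E) (z : ℂ) : E →L[ℂ] E :=
  if h : ∃ R : E →L[ℂ] E, IsResolventAt H z R then h.choose else 0

/-- The Cayley transform `(H - i)(H + i)⁻¹ = 1 - 2i (H + i)⁻¹`, a unitary operator if `H` is
self-adjoint. -/
def cayley (H : E →ₗ.[ℂ] E) : E →L[ℂ] E :=
  1 - (2 * Complex.I) • resolventOp H (-Complex.I)

/-- A function `f` on the real line, transported to the unit circle by
`λ ↦ (λ - i)/(λ + i)`, whose inverse is `z ↦ i (1 + z)/(1 - z)`; the point `1` stands for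
infinity and gets the value `0`. -/
def cayleySymbol (f : ℝ → ℂ) (z : ℂ) : ℂ :=
  if z = 1 then 0 else f (Complex.I * (1 + z) / (1 - z)).re

/-- The operator `f(H)`, for `f : ℝ → ℂ` continuous with compact support and `H` self-adjoint:
the continuous functional calculus of the Cayley transform. -/
def funcCalc (H : E →ₗ.[ℂ] E) (f : ℝ → ℂ) : E →L[ℂ] E :=
  cfc (cayleySymbol f) (cayley H)

/-- `e^{-itH} 𝒳(H)`: the function `λ ↦ e^{-itλ} 𝒳(λ)` of `H`. -/
def evolution (H : E →ₗ.[ℂ] E) (X : ℝ → ℝ) (t : ℝ) : E →L[ℂ] E :=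
  funcCalc H fun l => Complex.exp (-(Complex.I * t * l)) * (X l : ℂ)

/-- The eigenspace `ker (H - e)`: the `ψ ∈ dom H` with `H ψ = e ψ`. -/
def eigenspace (H : E →ₗ.[ℂ] E) (e : ℝ) : Submodule ℂ E :=
  H.graph.comap (LinearMap.prod LinearMap.id ((e : ℂ) • LinearMap.id))

/-- The eigenprojection `P_e = χ_{{e}}(H)`, the orthogonal projection onto `ker (H - e)`
(which is closed if `H` is self-adjoint). -/
def eigenproj (H : E →ₗ.[ℂ] E) (e : ℝ) : E →L[ℂ] E :=
  (eigenspace H e).topologicalClosure.starProjection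

/-- The spectral subspace `Ran χ_J(H)` of an open set `J`: the closed span of the ranges of the
operators `f(H)`, with `f` continuous and compactly supported in `J`. -/
def spectralSubspace (H : E →ₗ.[ℂ] E) (J : Set ℝ) : Submodule ℂ E :=
  (⨆ f ∈ {f : ℝ → ℂ | Continuous f ∧ HasCompactSupport f ∧ tsupport f ⊆ J},
    (funcCalc H f).range).topologicalClosure

/-- The spectral projection `χ_J(H)` of an open set `J`. -/
def spectralProj (H : E →ₗ.[ℂ] E) (J : Set ℝ) : E →L[ℂ] E :=
  (spectralSubspace H J).topologicalClosure.starProjection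

/-- `H` has pure point spectrum in the open set `J`: `Ran χ_J(H)` is the closed span of the
eigenvectors of `H` with eigenvalues in `J`. -/
def HasPurePointSpectrumIn (H : E →ₗ.[ℂ] E) (J : Set ℝ) : Prop :=
  spectralSubspace H J = (⨆ e ∈ J, eigenspace H e).topologicalClosure

/-- The index set of some Hilbert basis of `E`. -/
def basisIndex (E : Type*) [NormedAddCommGroup E] [InnerProductSpace ℂ E] [CompleteSpace E] :
    Set E :=
  (exists_hilbertBasis ℂ E).choose

/-- Some Hilbert basis of `E`. -/
def basis (E : Type*) [NormedAddCommGroup E] [InnerProductSpace ℂ E] [CompleteSpace E] :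
    HilbertBasis (basisIndex E) ℂ E :=
  (exists_hilbertBasis ℂ E).choose_spec.choose

/-- The Hilbert-Schmidt norm `‖A‖₂ = (∑ᵢ ‖A bᵢ‖²)^{1/2} ∈ [0, ∞]`; it does not depend on the
Hilbert basis `b`. -/
def hsNorm (A : E →L[ℂ] E) : ℝ≥0∞ :=
  (∑' i, ‖A (basis E i)‖ₑ ^ 2) ^ (1 / 2 : ℝ)

end Abstract

/-! ### Configuration space -/

variable {d : ℕ}

/-- A point of `ℤ^d`, seen in `ℝ^d`. The norm of `Fin d → ℝ` is `max |xᵢ|`. -/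
def latticePt (a : Fin d → ℤ) : Fin d → ℝ := fun i => (a i : ℝ)

/-- The counting measure of `ℤ^d`, as a measure on `ℝ^d`; its `L²` space is `ℓ²(ℤ^d)`. -/
def latticeMeasure (d : ℕ) : Measure (Fin d → ℝ) :=
  Measure.sum fun a : Fin d → ℤ => Measure.dirac (latticePt a)

/-- The Hilbert space `L²(ℝ^d, ν)`: it is `L²(ℝ^d)` for `ν = volume` and `ℓ²(ℤ^d)` for
`ν = latticeMeasure d`. -/
abbrev L2 (ν : Measure (Fin d → ℝ)) : Type := Lp ℂ 2 ν

theorem measurePreserving_sub {ν : Measure (Fin d → ℝ)} (hν : ν = volume ∨ ν = latticeMeasure d)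
    (a : Fin d → ℤ) : MeasurePreserving (fun x => x - latticePt a) ν ν := by
  rcases hν with rfl | rfl
  · exact MeasureTheory.measurePreserving_sub_right _ _
  · have hm : Measurable fun x : Fin d → ℝ => x - latticePt a := measurable_id.sub_const _
    refine ⟨hm, ?_⟩
    ext s hs
    rw [Measure.map_apply hm hs]
    simp only [latticeMeasure]
    rw [Measure.sum_apply _ (hm hs), Measure.sum_apply _ hs,
      ← (Equiv.subRight a).tsum_eq fun b => Measure.dirac (latticePt b) s]
    refine tsum_congr fun b => ?_
    rw [Measure.dirac_apply' _ (hm hs), Measure.dirac_apply' _ hs]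
    have : latticePt (Equiv.subRight a b) = latticePt b - latticePt a := by
      ext i; simp [latticePt]
    rw [this]; rfl

/-- The translation `(U_a ψ)(x) = ψ(x - a)`. -/
def translation {ν : Measure (Fin d → ℝ)} (hν : ν = volume ∨ ν = latticeMeasure d)
    (a : Fin d → ℤ) : L2 ν →ₗᵢ[ℂ] L2 ν :=
  Lp.compMeasurePreservingₗᵢ ℂ _ (measurePreserving_sub hν a)

/-- The open box `Λ₁(x)` with centre `x ∈ ℤ^d` and side length `1`. -/
def box (x : Fin d → ℤ) : Set (Fin d → ℝ) := Metric.ball (latticePt x) (1 / 2)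

theorem memLp_indicator_box {ν : Measure (Fin d → ℝ)} (x : Fin d → ℤ) (ψ : L2 ν) :
    MemLp ((box x).indicator (ψ : (Fin d → ℝ) → ℂ)) 2 ν :=
  (Lp.memLp ψ).indicator Metric.isOpen_ball.measurableSet

/-- The linear map `ψ ↦ χ_x ψ`. -/
def chiLin (ν : Measure (Fin d → ℝ)) (x : Fin d → ℤ) : L2 ν →ₗ[ℂ] L2 ν where
  toFun ψ := (memLp_indicator_box x ψ).toLp _
  map_add' ψ φ := by
    rw [← MemLp.toLp_add, MemLp.toLp_eq_toLp_iff]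
    filter_upwards [Lp.coeFn_add ψ φ] with y hy
    by_cases h : y ∈ box x
    · simpa only [Pi.add_apply, Set.indicator_of_mem h] using hy
    · simp only [Pi.add_apply, Set.indicator_of_notMem h, add_zero]
  map_smul' c ψ := by
    rw [RingHom.id_apply, ← MemLp.toLp_const_smul, MemLp.toLp_eq_toLp_iff]
    filter_upwards [Lp.coeFn_smul c ψ] with y hy
    by_cases h : y ∈ box x
    · simpa only [Pi.smul_apply, Set.indicator_of_mem h] using hy
    · simp only [Pi.smul_apply, Set.indicator_of_notMem h, smul_zero]

theorem norm_chiLin_le (ν : Measure (Fin d → ℝ)) (x : Fin d → ℤ) (ψ : L2 ν) :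
    ‖chiLin ν x ψ‖ ≤ 1 * ‖ψ‖ := by
  rw [one_mul]
  refine Lp.norm_le_norm_of_ae_le ?_
  filter_upwards [MemLp.coeFn_toLp (memLp_indicator_box x ψ)] with y hy
  change ‖(memLp_indicator_box x ψ).toLp _ y‖ ≤ _
  rw [hy]
  exact norm_indicator_le_norm_self _ _

/-- The operator `χ_x` of multiplication by the characteristic function of `Λ₁(x)`. -/
def chi (ν : Measure (Fin d → ℝ)) (x : Fin d → ℤ) : L2 ν →L[ℂ] L2 ν :=
  (chiLin ν x).mkContinuous 1 (norm_chiLin_le ν x)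

/-! ### Ergodic operators, moments and test functions -/

/-- `ω ↦ H ω` is a measurable family of self-adjoint operators on `L²(ℝ^d, ν)`, covariant under
the action `a +ᵥ ω` of `ℤ^d` on the probability space: `H_{a + ω} = U_a H_ω U_a*`. If the action
is ergodic, this is a `ℤ^d`-ergodic operator. -/
structure IsCovariantOperator {ν : Measure (Fin d → ℝ)} (hν : ν = volume ∨ ν = latticeMeasure d)
    {Ω : Type*} [MeasurableSpace Ω] [AddAction (Fin d → ℤ) Ω]
    (H : Ω → L2 ν →ₗ.[ℂ] L2 ν) : Prop where
  selfAdjoint : ∀ ω, IsSelfAdjoint (H ω)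
  measurable : ∀ z : ℂ, z.im ≠ 0 → ∀ φ ψ : L2 ν,
    Measurable fun ω => ⟪φ, resolventOp (H ω) z ψ⟫_ℂ
  covariant : ∀ (a : Fin d → ℤ) (ω : Ω) (ψ η : L2 ν),
    (ψ, η) ∈ (H ω).graph ↔
      (translation hν a ψ, translation hν a η) ∈ (H (a +ᵥ ω)).graph

/-- The moment `M_u(σ, ζ, 𝒳, t) = ‖e^{(σ/2)|X - u|^ζ} e^{-itH} 𝒳(H) χ_u‖₂² ∈ [0, ∞]`, that is
`∑ᵢ ∫ e^{σ|y - u|^ζ} |(e^{-itH} 𝒳(H) χ_u bᵢ)(y)|² dν(y)` for a Hilbert basis `b`. -/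
def moment {ν : Measure (Fin d → ℝ)} (H : L2 ν →ₗ.[ℂ] L2 ν) (u : Fin d → ℤ) (σ ζ : ℝ)
    (X : ℝ → ℝ) (t : ℝ) : ℝ≥0∞ :=
  ∑' i, ∫⁻ y, ENNReal.ofReal (Real.exp (σ * ‖y - latticePt u‖ ^ ζ)) *
    ‖(evolution H X t * chi ν u) (basis (L2 ν) i) y‖ₑ ^ 2 ∂ν

/-- The class `C^∞_{c,+}(I)` of smooth nonnegative functions with compact support in `I`. -/
def testFunctions (I : Set ℝ) : Set (ℝ → ℝ) :=
  {X | ContDiff ℝ (⊤ : ℕ∞) X ∧ HasCompactSupport X ∧ tsupport X ⊆ I ∧ ∀ l, 0 ≤ X l}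

end RandomOp

end

/-! Everything is compared with one time-free quantity, the correlator Q(x,u) = ∑ₑ 𝒳(e)² ‖χ_x P_e
χ_u‖₂². All five properties turn out to be equivalent to subexponential decay of E Q(x,u) in |x - u|
(`CorrelatorDecay`).

Pure point spectrum gives e^{-itH} 𝒳(H) = ∑ₑ e^{-ite} 𝒳(e) P_e
(`HasPurePointSpectrumIn.hasSum_funcCalc`). Wiener's theorem on each matrix element, followed by
Fatou, bounds Q by the time mean of ‖χ_x e^{-itH} 𝒳(H) χ_u‖₂² (`correlator_le_liminf`). The
time-averaged moment at u = 0 therefore controls E Q(x,0), and covariance makes this control uniform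
in u. So (i) implies decay.

The converse must bound the dynamics by Q uniformly in time. Write k_e(x,u) = ‖χ_x P_e χ_u‖₂. Since
the phases have modulus one, ∑ₑ 𝒳(e) k_e(x,u) dominates the evolution for all t. From P_e = ∑_v P_e
χ_v P_e one gets k_e(x,u) ≤ ∑_v k_e(x,v) k_e(v,u). Split 𝒳 k_e(x,v) k_e(v,u) as (𝒳 k_e(x,v))^{1/2}
(𝒳 k_e(v,u))^{1/2} times k_e(x,v)^{1/2} k_e(v,u)^{1/2}: the first two factors are at most
Q(x,v)^{1/4} and Q(v,u)^{1/4}, and the rest is summable over e by Cauchy–Schwarz and the local trace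
bound (`TraceBound.tsum_mul_eigenKernel_le_tsum`). Hölder in ω and convolution of subexponential
kernels keep the decay, which yields (iii) and (iv).

Finally (iv) implies (v), because sup_e 𝒳(e) k_e ≤ Q^{1/2} ≤ sup_t by Wiener again; (v) implies
decay, because Q ≤ (∑ₑ 𝒳 k_e) sup_e 𝒳 k_e and the sum is bounded. The passages (iii) → (ii) → (i)
only compare averages. -/

noncomputable section

namespace RandomOp

/-! ### Self-adjoint operators, the Cayley transform and functional calculus -/

section SelfAdjoint

variable {E : Type*} [NormedAddCommGroup E] [InnerProductSpace ℂ E] [CompleteSpace E]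
  {H : E →ₗ.[ℂ] E}

theorem inner_graph_symm (hH : IsSelfAdjoint H) {p q : E × E} (hp : p ∈ H.graph)
    (hq : q ∈ H.graph) : ⟪p.2, q.1⟫_ℂ = ⟪p.1, q.2⟫_ℂ := by
  obtain ⟨x, hx1, hx2⟩ := (LinearPMap.mem_graph_iff H).1 hp
  obtain ⟨y, hy1, hy2⟩ := (LinearPMap.mem_graph_iff H).1 hq
  have h := LinearPMap.adjoint_isFormalAdjoint hH.dense_domain
  rw [LinearPMap.isSelfAdjoint_def.1 hH] at h
  have := h x y
  rw [← hx1, ← hx2, ← hy1, ← hy2]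
  exact this

/-- The maximality half of self-adjointness: the weak equation puts η in the domain of H* = H. -/
theorem mem_graph_of_inner (hH : IsSelfAdjoint H) {η ξ : E}
    (h : ∀ x : H.domain, ⟪ξ, (x : E)⟫_ℂ = ⟪η, H x⟫_ℂ) : (η, ξ) ∈ H.graph := by
  have hd := LinearPMap.mem_adjoint_domain_of_exists (T := H) η ⟨ξ, h⟩
  have ha := LinearPMap.adjoint_apply_eq hH.dense_domain ⟨η, hd⟩ h
  have hm : (η, ξ) ∈ H.adjoint.graph := by
    have := LinearPMap.mem_graph H.adjoint ⟨η, hd⟩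
    rwa [ha] at this
  rwa [LinearPMap.isSelfAdjoint_def.1 hH] at hm

/-- The cross term vanishes because ⟨Hψ, ψ⟩ is real and z is imaginary. This identity yields
injectivity and closed range of H ∓ i, and the isometry of the Cayley transform. -/
theorem norm_sub_smul_sq (hH : IsSelfAdjoint H) {z : ℂ} (hz : z = Complex.I ∨ z = -Complex.I)
    {p : E × E} (hp : p ∈ H.graph) : ‖p.2 - z • p.1‖ ^ 2 = ‖p.2‖ ^ 2 + ‖p.1‖ ^ 2 := by
  have him : (⟪p.2, p.1⟫_ℂ).im = 0 := by
    have h1 := inner_graph_symm hH hp hp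
    have h2 := congrArg Complex.im (inner_conj_symm p.2 p.1)
    rw [Complex.conj_im, ← h1] at h2
    linarith
  have hnz : ‖z‖ = 1 := by rcases hz with rfl | rfl <;> simp
  have hre : z.re = 0 := by rcases hz with rfl | rfl <;> simp
  rw [@norm_sub_sq ℂ, inner_smul_right, norm_smul, hnz]
  simp [him, hre]

/-- The map `(ψ, H ψ) ↦ H ψ - z ψ` on the graph of `H`. -/
def graphSub (H : E →ₗ.[ℂ] E) (z : ℂ) : H.graph →L[ℂ] E :=
  (ContinuousLinearMap.snd ℂ E E - z • ContinuousLinearMap.fst ℂ E E).comp H.graph.subtypeL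

omit [CompleteSpace E] in
theorem graphSub_apply (z : ℂ) (p : H.graph) : graphSub H z p = p.1.2 - z • p.1.1 := rfl

theorem norm_le_norm_graphSub (hH : IsSelfAdjoint H) {z : ℂ}
    (hz : z = Complex.I ∨ z = -Complex.I) (p : H.graph) : ‖p‖ ≤ ‖graphSub H z p‖ := by
  have h := norm_sub_smul_sq hH hz p.2
  rw [graphSub_apply, Submodule.coe_norm, Prod.norm_def]
  refine max_le ?_ ?_ <;> refine (sq_le_sq₀ (norm_nonneg _) (norm_nonneg _)).1 ?_ <;> rw [h]
  · nlinarith [sq_nonneg ‖p.1.2‖]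
  · nlinarith [sq_nonneg ‖p.1.1‖]

/-- The map is bounded below on a complete space, so its range is closed. A vector η orthogonal to
the range satisfies Hη = z̄η, and the norm identity at z̄ forces η = 0. -/
theorem graphSub_surjective (hH : IsSelfAdjoint H) {z : ℂ}
    (hz : z = Complex.I ∨ z = -Complex.I) : (graphSub H z).range = ⊤ := by
  have : CompleteSpace H.graph := hH.isClosed.completeSpace_coe
  have hcl : IsClosed ((graphSub H z).range : Set E) := by
    have ha : AntilipschitzWith 1 (graphSub H z) :=
      ContinuousLinearMap.antilipschitz_of_bound _ fun p => by
        simpa using norm_le_norm_graphSub hH hz p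
    exact ha.isClosed_range (graphSub H z).uniformContinuous
  have : CompleteSpace (graphSub H z).range := hcl.completeSpace_coe
  rw [← Submodule.orthogonal_eq_bot_iff, Submodule.eq_bot_iff]
  intro η hη
  have hz' : star z = Complex.I ∨ star z = -Complex.I := by
    rcases hz with rfl | rfl <;> simp
  have hg : (η, star z • η) ∈ H.graph := by
    refine mem_graph_of_inner hH fun x => ?_
    have h := (Submodule.mem_orthogonal' _ _).1 hη _
      (LinearMap.mem_range_self (graphSub H z : H.graph →ₗ[ℂ] E) ⟨_, LinearPMap.mem_graph H x⟩)
    have h' : ⟪η, H x - z • (x : E)⟫_ℂ = 0 := h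
    rw [inner_sub_right, inner_smul_right, sub_eq_zero] at h'
    rw [inner_smul_left, h']
    simp
  have := norm_sub_smul_sq hH hz' hg
  simp only [sub_self, norm_zero] at this
  have h0 : ‖η‖ ^ 2 = 0 := by nlinarith [sq_nonneg ‖star z • η‖, sq_nonneg ‖η‖]
  simpa using h0

theorem exists_isResolventAt (hH : IsSelfAdjoint H) {z : ℂ}
    (hz : z = Complex.I ∨ z = -Complex.I) : ∃ R : E →L[ℂ] E, IsResolventAt H z R := by
  have : CompleteSpace H.graph := hH.isClosed.completeSpace_coe
  have hker : (graphSub H z).ker = ⊥ := by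
    rw [Submodule.eq_bot_iff]
    intro p hp
    have hp' : graphSub H z p = 0 := hp
    simpa [hp'] using norm_le_norm_graphSub hH hz p
  let e := ContinuousLinearEquiv.ofBijective (graphSub H z) hker (graphSub_surjective hH hz)
  have he : ∀ p, e p = graphSub H z p := fun p => rfl
  refine ⟨(ContinuousLinearMap.fst ℂ E E).comp (H.graph.subtypeL.comp (e.symm : E →L[ℂ] H.graph)),
    fun η => ?_, fun ψ => ?_⟩
  · have hm : ((e.symm η).1.1, (e.symm η).1.2) ∈ H.graph := (e.symm η).2
    refine ⟨LinearPMap.mem_domain_of_mem_graph hm, ?_⟩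
    have h2 := (LinearPMap.image_iff (LinearPMap.mem_domain_of_mem_graph hm)).2 hm
    have h3 : e (e.symm η) = η := e.apply_symm_apply η
    rw [he, graphSub_apply, h2] at h3
    exact h3
  · have : H ψ - z • (ψ : E) = e ⟨_, LinearPMap.mem_graph H ψ⟩ := rfl
    rw [this]
    simp

theorem isResolventAt_resolventOp (hH : IsSelfAdjoint H) {z : ℂ}
    (hz : z = Complex.I ∨ z = -Complex.I) : IsResolventAt H z (resolventOp H z) := by
  have h := exists_isResolventAt hH hz
  rw [resolventOp, dif_pos h]
  exact h.choose_spec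

theorem cayley_apply_of_mem_graph (hH : IsSelfAdjoint H) {ψ ξ : E} (h : (ψ, ξ) ∈ H.graph) :
    cayley H (ξ + Complex.I • ψ) = ξ - Complex.I • ψ := by
  have hd := LinearPMap.mem_domain_of_mem_graph h
  have h1 := (isResolventAt_resolventOp hH (Or.inr rfl)).2 ⟨ψ, hd⟩
  rw [← (LinearPMap.image_iff hd).2 h] at h1
  simp only [neg_smul, sub_neg_eq_add] at h1
  simp only [cayley, sub_apply, one_apply_eq_self,
    smul_apply, h1]
  module

theorem exists_mem_graph (hH : IsSelfAdjoint H) {z : ℂ}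
    (hz : z = Complex.I ∨ z = -Complex.I) (η : E) :
    ∃ p ∈ H.graph, p.2 - z • p.1 = η := by
  have h : η ∈ (graphSub H z).range := by rw [graphSub_surjective hH hz]; trivial
  obtain ⟨p, hp⟩ := h
  exact ⟨p.1, p.2, hp⟩

theorem cayley_mem_unitary (hH : IsSelfAdjoint H) : cayley H ∈ unitary (E →L[ℂ] E) := by
  have h1 : star (cayley H) * cayley H = 1 := by
    rw [ContinuousLinearMap.star_eq_adjoint]
    refine (ContinuousLinearMap.norm_map_iff_adjoint_comp_self (cayley H)).1 fun η => ?_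
    obtain ⟨p, hp, rfl⟩ := exists_mem_graph hH (Or.inr rfl) η
    have h2 := norm_sub_smul_sq hH (Or.inl rfl) hp
    have h3 := norm_sub_smul_sq hH (Or.inr rfl) hp
    have h4 : cayley H (p.2 - -Complex.I • p.1) = p.2 - Complex.I • p.1 := by
      rw [neg_smul, sub_neg_eq_add]
      exact cayley_apply_of_mem_graph hH hp
    rw [h4]
    exact (sq_eq_sq₀ (norm_nonneg _) (norm_nonneg _)).1 (h2.trans h3.symm)
  refine ⟨h1, ?_⟩
  -- Every ξ has the form Hψ - iψ, hence lies in the range of the Cayley transform; an isometry with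
  -- full range is unitary.
  ext ξ
  obtain ⟨p, hp, rfl⟩ := exists_mem_graph hH (Or.inl rfl) ξ
  rw [← cayley_apply_of_mem_graph hH hp]
  have h5 := congrArg (fun A : E →L[ℂ] E => cayley H (A (p.2 + Complex.I • p.1))) h1
  simpa using h5

theorem cayley_isStarNormal (hH : IsSelfAdjoint H) : IsStarNormal (cayley H) :=
  ⟨by
    have h := cayley_mem_unitary hH
    rw [Commute, SemiconjBy, h.1, h.2]⟩

theorem spectrum_cayley_subset (hH : IsSelfAdjoint H) :
    spectrum ℂ (cayley H) ⊆ Metric.sphere 0 1 :=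
  spectrum.subset_circle_of_unitary (cayley_mem_unitary hH)

/-- The image of the real number `e` under the Cayley transform. -/
def cayleyPt (e : ℝ) : ℂ := ((e : ℂ) - Complex.I) / (e + Complex.I)

theorem add_I_ne_zero (e : ℝ) : (e : ℂ) + Complex.I ≠ 0 := fun h => by
  simpa using congrArg Complex.im h

theorem cayleySymbol_cayleyPt (f : ℝ → ℂ) (e : ℝ) : cayleySymbol f (cayleyPt e) = f e := by
  have h0 := add_I_ne_zero e
  have h1 : 1 - cayleyPt e = 2 * Complex.I / (e + Complex.I) := by
    rw [cayleyPt]; field_simp; ring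
  have h2 : 1 + cayleyPt e = 2 * e / (e + Complex.I) := by
    rw [cayleyPt]; field_simp; ring
  have hne : cayleyPt e ≠ 1 := by
    intro h
    rw [h, sub_self] at h1
    have : 2 * Complex.I / ((e : ℂ) + Complex.I) ≠ 0 := div_ne_zero (by simp) h0
    exact this h1.symm
  have h3 : Complex.I * (1 + cayleyPt e) / (1 - cayleyPt e) = (e : ℂ) := by
    rw [h1, h2]; field_simp
  rw [cayleySymbol, if_neg hne, h3, Complex.ofReal_re]

omit [CompleteSpace E] in
theorem mem_eigenspace {e : ℝ} {ψ : E} : ψ ∈ eigenspace H e ↔ (ψ, (e : ℂ) • ψ) ∈ H.graph :=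
  Iff.rfl

theorem cayley_apply_eigenvector (hH : IsSelfAdjoint H) {e : ℝ} {ψ : E}
    (h : ψ ∈ eigenspace H e) : cayley H ψ = cayleyPt e • ψ := by
  have h1 := cayley_apply_of_mem_graph hH (mem_eigenspace.1 h)
  rw [← add_smul, ← sub_smul, map_smul] at h1
  have h0 := add_I_ne_zero e
  rw [cayleyPt, div_eq_inv_mul, mul_smul, ← h1, smul_smul, inv_mul_cancel₀ h0, one_smul]

theorem isClosed_eigenspace (hH : IsSelfAdjoint H) (e : ℝ) :
    IsClosed (eigenspace H e : Set E) := by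
  have hc : Continuous fun ψ : E => (ψ, (e : ℂ) • ψ) := by fun_prop
  exact hH.isClosed.preimage hc

theorem inner_eigenspace_eq_zero (hH : IsSelfAdjoint H) {e e' : ℝ} (hne : e ≠ e') {ψ φ : E}
    (hψ : ψ ∈ eigenspace H e) (hφ : φ ∈ eigenspace H e') : ⟪ψ, φ⟫_ℂ = 0 := by
  have h := inner_graph_symm hH (mem_eigenspace.1 hψ) (mem_eigenspace.1 hφ)
  simp only [inner_smul_left, inner_smul_right, Complex.conj_ofReal] at h
  have h2 : ((e : ℂ) - e') * ⟪ψ, φ⟫_ℂ = 0 := by rw [sub_mul, h, sub_self]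
  refine (mul_eq_zero.1 h2).resolve_left ?_
  exact sub_ne_zero.2 (by exact_mod_cast hne)

/-- Stone–Weierstrass: the functions k with k(U)ψ = k(μ)ψ form a closed subalgebra that contains the
coordinate and, since U*ψ = μ̄ψ for unitary U, its conjugate. -/
theorem cfc_apply_eigenvector {U : E →L[ℂ] E} (hU : U ∈ unitary (E →L[ℂ] E)) {μ : ℂ} {ψ : E}
    (hψ : U ψ = μ • ψ) (hψ0 : ψ ≠ 0) {g : ℂ → ℂ} (hg : ContinuousOn g (spectrum ℂ U)) :
    cfc g U ψ = g μ • ψ := by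
  have hn : IsStarNormal U := ⟨by rw [Commute, SemiconjBy, hU.1, hU.2]⟩
  have hμ : μ ∈ spectrum ℂ U := by
    rw [spectrum.mem_iff]
    intro hu
    obtain ⟨u, hu⟩ := hu
    have h0 : (u : E →L[ℂ] E) ψ = 0 := by
      rw [hu]; simp [hψ, Algebra.algebraMap_eq_smul_one]
    have := congrArg (fun A : E →L[ℂ] E => A ψ) u.inv_mul
    simp only [mul_apply_eq_comp, h0, map_zero, one_apply_eq_self] at this
    exact hψ0 this.symm
  have hμ1 : star μ * μ = 1 := by
    have h1 : ‖μ‖ = 1 := by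
      have := spectrum.subset_circle_of_unitary hU hμ
      simpa using this
    have := Complex.conj_mul' μ
    rw [h1] at this
    simpa using this
  have hψ' : (star U) ψ = star μ • ψ := by
    have := congrArg (fun A : E →L[ℂ] E => A ψ) hU.1
    simp only [mul_apply_eq_comp, hψ, map_smul, one_apply_eq_self] at this
    rw [← this, smul_smul, hμ1, this, one_smul]
  have key : ∀ k : C(spectrum ℂ U, ℂ), (cfcHom hn k : E →L[ℂ] E) ψ = k ⟨μ, hμ⟩ • ψ := by
    intro k
    induction k using ContinuousMap.induction_on_of_compact with
    | const r =>
      have : ContinuousMap.const (spectrum ℂ U) r = algebraMap ℂ C(spectrum ℂ U, ℂ) r := rfl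
      rw [this, AlgHomClass.commutes]
      simp [Algebra.algebraMap_eq_smul_one]
    | id => rw [cfcHom_id]; exact hψ
    | star_id => rw [map_star, cfcHom_id]; exact hψ'
    | add f g hf hg => simp [hf, hg, add_smul]
    | mul f g hf hg => 
      rw [map_mul, mul_apply_eq_comp, hg, map_smul, hf, smul_smul, mul_comm]
      rfl
    | frequently f hf =>
      have hcl : IsClosed {k : C(spectrum ℂ U, ℂ) |
          (cfcHom hn k : E →L[ℂ] E) ψ = k ⟨μ, hμ⟩ • ψ} := by
        refine isClosed_eq ?_ ?_
        · exact (ContinuousLinearMap.apply ℂ E ψ).continuous.comp (cfcHom_continuous hn)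
        · exact (ContinuousEvalConst.continuous_eval_const _).smul continuous_const
      exact hcl.mem_of_frequently_of_tendsto hf Filter.tendsto_id
  rw [cfc_apply g U hn hg, key]
  rfl

/-- Taking the real part in `cayleySymbol` thus loses nothing on the circle. At z = 1 both sides are
0 by the convention for division by zero. -/
theorem cayleyInv_re (z : ℂ) (hz : ‖z‖ = 1) :
    Complex.I * (1 + z) / (1 - z) = ((Complex.I * (1 + z) / (1 - z)).re : ℂ) := by
  by_cases h1 : z = 1
  · simp [h1]
  have hz0 : z ≠ 0 := by rintro rfl; simp at hz
  have hzz : (starRingEnd ℂ) z = z⁻¹ := by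
    rw [eq_comm, Complex.inv_def, Complex.normSq_eq_norm_sq, hz]; simp
  have h2 : 1 - z ≠ 0 := sub_ne_zero.2 (Ne.symm h1)
  have h3 : z - 1 ≠ 0 := sub_ne_zero.2 h1
  refine (Complex.conj_eq_iff_re.1 ?_).symm
  simp only [map_div₀, map_mul, map_add, map_sub, map_one, Complex.conj_I, hzz]
  have h4 : 1 - z⁻¹ ≠ 0 := by
    rw [sub_ne_zero]; intro h; exact h1 (inv_eq_one.1 h.symm)
  rw [div_eq_div_iff h4 h2]
  field_simp
  ring

/-- Only the point 1 needs care: the inverse Cayley transform tends to infinity there, so compact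
support makes the symbol vanish nearby. -/
theorem continuousOn_cayleySymbol {f : ℝ → ℂ} (hf : Continuous f) (hc : HasCompactSupport f) :
    ContinuousOn (cayleySymbol f) (Metric.sphere 0 1) := by
  intro z hz
  by_cases h1 : z = 1
  · subst h1
    obtain ⟨M, hM⟩ := hc.isCompact.isBounded.subset_closedBall 0
    have hM0 : 0 < |M| + 1 := by positivity
    have hev : ∀ᶠ w in nhdsWithin (1 : ℂ) (Metric.sphere 0 1), cayleySymbol f w = 0 := by
      -- The radius is at most 1, so |1 + w| ≥ 1 and |1 + w| / |1 - w| > |M| + 1, which is outside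
      -- the support of f.
      have hb : Metric.ball (1 : ℂ) (1 / (|M| + 1)) ∈ nhds (1 : ℂ) :=
        Metric.ball_mem_nhds _ (by positivity)
      filter_upwards [nhdsWithin_le_nhds hb, self_mem_nhdsWithin] with w hw hw1
      by_cases hw2 : w = 1
      · simp [cayleySymbol, hw2]
      rw [cayleySymbol, if_neg hw2]
      by_contra hne
      have hmem := hM (subset_tsupport f (Function.mem_support.2 hne))
      rw [mem_closedBall_zero_iff] at hmem
      have hw3 : ‖w‖ = 1 := by simpa using hw1
      have h4 := congrArg norm (cayleyInv_re w hw3)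
      rw [Complex.norm_real] at h4
      rw [← h4, norm_div, norm_mul, Complex.norm_I, one_mul] at hmem
      have h5 : ‖1 - w‖ < 1 / (|M| + 1) := by
        rw [mem_ball_iff_norm] at hw
        rwa [norm_sub_rev]
      have h6 : 0 < ‖1 - w‖ := norm_pos_iff.2 (sub_ne_zero.2 (Ne.symm hw2))
      have h7 : 1 ≤ ‖1 + w‖ := by
        have h8 : ‖(2 : ℂ)‖ ≤ ‖1 + w‖ + ‖1 - w‖ := by
          have : (2 : ℂ) = (1 + w) + (1 - w) := by ring
          rw [this]; exact norm_add_le _ _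
        have h9 : 1 / (|M| + 1) ≤ 1 := by
          rw [div_le_one hM0]; linarith [abs_nonneg M]
        rw [Complex.norm_ofNat] at h8
        linarith
      rw [div_le_iff₀ h6] at hmem
      rw [lt_div_iff₀ hM0] at h5
      nlinarith [le_abs_self M]
    have h0 : cayleySymbol f 1 = 0 := by simp [cayleySymbol]
    rw [ContinuousWithinAt, h0]
    exact (Filter.tendsto_congr' hev).2 tendsto_const_nhds
  · refine ContinuousAt.continuousWithinAt ?_
    have hev : cayleySymbol f =ᶠ[nhds z] fun w => f (Complex.I * (1 + w) / (1 - w)).re := by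
      filter_upwards [isOpen_ne.mem_nhds h1] with w hw
      rw [cayleySymbol, if_neg hw]
    refine ContinuousAt.congr ?_ hev.symm
    refine hf.continuousAt.comp (Complex.continuous_re.continuousAt.comp ?_)
    exact ContinuousAt.div (by fun_prop) (by fun_prop) (sub_ne_zero.2 (Ne.symm h1))

theorem funcCalc_apply_eigenvector (hH : IsSelfAdjoint H) {f : ℝ → ℂ} (hf : Continuous f)
    (hc : HasCompactSupport f) {e : ℝ} {ψ : E} (h : ψ ∈ eigenspace H e) :
    funcCalc H f ψ = f e • ψ := by
  by_cases h0 : ψ = 0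
  · simp [h0]
  rw [funcCalc, cfc_apply_eigenvector (cayley_mem_unitary hH) (cayley_apply_eigenvector hH h) h0
    ((continuousOn_cayleySymbol hf hc).mono (spectrum_cayley_subset hH)), cayleySymbol_cayleyPt]

theorem star_funcCalc (f : ℝ → ℂ) : star (funcCalc H f) = funcCalc H fun l => star (f l) := by
  rw [funcCalc, ← cfc_star, funcCalc]
  congr 1
  ext z
  by_cases h : z = 1 <;> simp [cayleySymbol, h]

theorem norm_funcCalc_sub_le (hH : IsSelfAdjoint H) {f g : ℝ → ℂ} (hf : Continuous f)
    (hfc : HasCompactSupport f) (hg : Continuous g) (hgc : HasCompactSupport g) {c : ℝ}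
    (hc : 0 ≤ c) (h : ∀ l, ‖f l - g l‖ ≤ c) : ‖funcCalc H f - funcCalc H g‖ ≤ c := by
  have hn := cayley_isStarNormal hH
  rw [funcCalc, funcCalc, ← cfc_sub _ _ _
    ((continuousOn_cayleySymbol hf hfc).mono (spectrum_cayley_subset hH))
    ((continuousOn_cayleySymbol hg hgc).mono (spectrum_cayley_subset hH))]
  refine norm_cfc_le hc fun z _ => ?_
  by_cases h1 : z = 1
  · simp [cayleySymbol, h1, hc]
  · simpa [cayleySymbol, h1] using h _

end SelfAdjoint

/-! ### Eigenprojections and the eigenvalue expansion of f(H) -/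

section Eigenprojections

variable {E : Type*} [NormedAddCommGroup E] [InnerProductSpace ℂ E] [CompleteSpace E]
  {H : E →ₗ.[ℂ] E}

theorem eigenproj_apply_mem (hH : IsSelfAdjoint H) (e : ℝ) (ψ : E) :
    eigenproj H e ψ ∈ eigenspace H e := by
  have h : eigenproj H e ψ ∈ (eigenspace H e).topologicalClosure :=
    Submodule.starProjection_apply_mem _ ψ
  rwa [(isClosed_eigenspace hH e).submodule_topologicalClosure_eq] at h

theorem eigenproj_apply_of_mem {e : ℝ} {ψ : E} (h : ψ ∈ eigenspace H e) :
    eigenproj H e ψ = ψ :=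
  Submodule.starProjection_eq_self_iff.2 (Submodule.le_topologicalClosure _ h)

theorem inner_eigenproj (e : ℝ) (φ ψ : E) :
    ⟪eigenproj H e φ, ψ⟫_ℂ = ⟪φ, eigenproj H e ψ⟫_ℂ :=
  Submodule.inner_starProjection_left_eq_right _ φ ψ

theorem star_eigenproj (e : ℝ) : star (eigenproj H e) = eigenproj H e :=
  isSelfAdjoint_starProjection _

theorem eigenproj_mul_self (e : ℝ) : eigenproj H e * eigenproj H e = eigenproj H e :=
  (Submodule.isIdempotentElem_starProjection _)

theorem orthogonalFamily_eigenspace (hH : IsSelfAdjoint H) :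
    OrthogonalFamily ℂ (fun e : ℝ => eigenspace H e) fun e => (eigenspace H e).subtypeₗᵢ :=
  fun _ _ hne ψ φ => inner_eigenspace_eq_zero hH hne ψ.2 φ.2

/-- Bessel's inequality: the sum equals both ‖∑ P_e ψ‖² and ⟨ψ, ∑ P_e ψ⟩, and Cauchy–Schwarz
compares the two. -/
theorem sum_norm_eigenproj_sq_le (hH : IsSelfAdjoint H) (ψ : E) (s : Finset ℝ) :
    ∑ e ∈ s, ‖eigenproj H e ψ‖ ^ 2 ≤ ‖ψ‖ ^ 2 := by
  have h1 : ‖∑ e ∈ s, eigenproj H e ψ‖ ^ 2 = ∑ e ∈ s, ‖eigenproj H e ψ‖ ^ 2 :=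
    (orthogonalFamily_eigenspace hH).norm_sum
      (fun e => ⟨eigenproj H e ψ, eigenproj_apply_mem hH e ψ⟩) s
  have h2 : ⟪ψ, ∑ e ∈ s, eigenproj H e ψ⟫_ℂ = ((∑ e ∈ s, ‖eigenproj H e ψ‖ ^ 2 : ℝ) : ℂ) := by
    rw [inner_sum]
    push_cast
    refine Finset.sum_congr rfl fun e _ => ?_
    have h := inner_self_eq_norm_sq_to_K (𝕜 := ℂ) (eigenproj H e ψ)
    rw [inner_eigenproj, ← mul_apply_eq_comp, eigenproj_mul_self] at h
    exact h
  set S := ∑ e ∈ s, ‖eigenproj H e ψ‖ ^ 2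
  have hS : 0 ≤ S := Finset.sum_nonneg fun _ _ => sq_nonneg _
  have h3 : S ≤ ‖ψ‖ * ‖∑ e ∈ s, eigenproj H e ψ‖ := by
    have := norm_inner_le_norm (𝕜 := ℂ) ψ (∑ e ∈ s, eigenproj H e ψ)
    rwa [h2, Complex.norm_real, Real.norm_of_nonneg hS] at this
  nlinarith [sq_nonneg (‖ψ‖ - ‖∑ e ∈ s, eigenproj H e ψ‖)]

theorem summable_norm_eigenproj_sq (hH : IsSelfAdjoint H) (ψ : E) :
    Summable fun e : ℝ => ‖eigenproj H e ψ‖ ^ 2 :=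
  summable_of_sum_le (fun _ => sq_nonneg _) (sum_norm_eigenproj_sq_le hH ψ)

theorem tsum_enorm_eigenproj_sq_le (hH : IsSelfAdjoint H) (ψ : E) :
    ∑' e : ℝ, ‖eigenproj H e ψ‖ₑ ^ 2 ≤ ‖ψ‖ₑ ^ 2 := by
  have h : ∀ x : E, ‖x‖ₑ ^ 2 = ENNReal.ofReal (‖x‖ ^ 2) := fun x => by
    rw [ENNReal.ofReal_pow (norm_nonneg _), ofReal_norm]
  simp_rw [h]
  rw [← ENNReal.ofReal_tsum_of_nonneg (fun _ => sq_nonneg _) (summable_norm_eigenproj_sq hH ψ)]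
  exact ENNReal.ofReal_le_ofReal (Real.tsum_le_of_sum_le (fun _ => sq_nonneg _)
    (sum_norm_eigenproj_sq_le hH ψ))

theorem summable_eigenproj (hH : IsSelfAdjoint H) (ψ : E) :
    Summable fun e : ℝ => eigenproj H e ψ :=
  ((orthogonalFamily_eigenspace hH).summable_iff_norm_sq_summable
    (fun e => ⟨eigenproj H e ψ, eigenproj_apply_mem hH e ψ⟩)).2 (summable_norm_eigenproj_sq hH ψ)

theorem eigenproj_apply_eigenproj_of_ne (hH : IsSelfAdjoint H) {e e' : ℝ} (hne : e ≠ e') (ψ : E) :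
    eigenproj H e (eigenproj H e' ψ) = 0 := by
  rw [← inner_self_eq_zero (𝕜 := ℂ), inner_eigenproj, ← mul_apply_eq_comp, eigenproj_mul_self]
  exact inner_eigenspace_eq_zero hH hne.symm (eigenproj_apply_mem hH _ _)
    (eigenproj_apply_mem hH _ _)

theorem eigenproj_sub_tsum (hH : IsSelfAdjoint H) (e : ℝ) (ψ : E) :
    eigenproj H e (ψ - ∑' e', eigenproj H e' ψ) = 0 := by
  rw [map_sub, ContinuousLinearMap.map_tsum _ (summable_eigenproj hH ψ), sub_eq_zero,
    tsum_eq_single e fun e' he' => eigenproj_apply_eigenproj_of_ne hH he'.symm ψ,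
    ← mul_apply_eq_comp, eigenproj_mul_self]

theorem funcCalc_mem_spectralSubspace {J : Set ℝ} {f : ℝ → ℂ} (hf : Continuous f)
    (hc : HasCompactSupport f) (hs : tsupport f ⊆ J) (ψ : E) :
    funcCalc H f ψ ∈ spectralSubspace H J := by
  refine Submodule.le_topologicalClosure _ ?_
  refine Submodule.mem_iSup_of_mem f (Submodule.mem_iSup_of_mem ⟨hf, hc, hs⟩ ?_)
  exact LinearMap.mem_range_self (funcCalc H f : E →ₗ[ℂ] E) ψ

theorem inner_eq_zero_of_eigenproj_eq_zero {J : Set ℝ} {r η : E}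
    (hr : ∀ e, eigenproj H e r = 0) (hη : η ∈ (⨆ e ∈ J, eigenspace H e).topologicalClosure) :
    ⟪η, r⟫_ℂ = 0 := by
  have h1 : (⨆ e ∈ J, eigenspace H e) ≤ (ℂ ∙ r)ᗮ := by
    refine iSup₂_le fun e _ φ hφ => ?_
    rw [Submodule.mem_orthogonal_singleton_iff_inner_left, ← eigenproj_apply_of_mem hφ,
      inner_eigenproj, hr, inner_zero_right]
  have h2 := Submodule.topologicalClosure_minimal _ h1 (Submodule.isClosed_orthogonal _) hη
  rwa [Submodule.mem_orthogonal_singleton_iff_inner_left] at h2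

/-- If `H` has pure point spectrum in `J`, then `f(H) = ∑ f(e) P_e` for `f` supported in `J`. -/
theorem HasPurePointSpectrumIn.hasSum_funcCalc (hH : IsSelfAdjoint H) {J : Set ℝ}
    (hpp : HasPurePointSpectrumIn H J) {f : ℝ → ℂ} (hf : Continuous f)
    (hc : HasCompactSupport f) (hs : tsupport f ⊆ J) (ψ : E) :
    HasSum (fun e : ℝ => f e • eigenproj H e ψ) (funcCalc H f ψ) := by
  have h1 := (summable_eigenproj hH ψ).hasSum.mapL (funcCalc H f)
  have h2 : ∀ e, funcCalc H f (eigenproj H e ψ) = f e • eigenproj H e ψ := fun e =>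
    funcCalc_apply_eigenvector hH hf hc (eigenproj_apply_mem hH e ψ)
  simp only [h2] at h1
  convert h1 using 1
  -- With r = ψ - ∑ P_e ψ, one has ‖f(H)r‖² = ⟨f̄(H)f(H)r, r⟩. The left vector lies in the spectral
  -- subspace, which is spanned by eigenvectors, and r is orthogonal to all of these.
  rw [← sub_eq_zero, ← map_sub, ← inner_self_eq_zero (𝕜 := ℂ),
    ← ContinuousLinearMap.adjoint_inner_left, ← ContinuousLinearMap.star_eq_adjoint,
    star_funcCalc]
  refine inner_eq_zero_of_eigenproj_eq_zero (J := J) (fun e => eigenproj_sub_tsum hH e ψ) ?_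
  rw [← hpp]
  refine funcCalc_mem_spectralSubspace hf.star (hc.comp_left (g := star) (star_zero _)) ?_ _
  exact (tsupport_comp_subset (star_zero ℂ) f).trans hs

/-- If f is a bump function supported in (a, b) with f(e) = 1, then ψ = f(H)ψ. -/
theorem eigenspace_le_spectralSubspace (hH : IsSelfAdjoint H) {a b e : ℝ} (he : e ∈ Ioo a b) :
    eigenspace H e ≤ spectralSubspace H (Ioo a b) := by
  intro ψ hψ
  obtain ⟨f, hf1, hf2, hf3, -, hf5⟩ := exists_contDiff_tsupport_subset (n := 0)
    (isOpen_Ioo.mem_nhds he)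
  have hc : Continuous fun l => (f l : ℂ) := Complex.continuous_ofReal.comp hf3.continuous
  have hs : HasCompactSupport fun l => (f l : ℂ) := hf2.comp_left Complex.ofReal_zero
  have h := funcCalc_mem_spectralSubspace (H := H) hc hs ((tsupport_comp_subset
    Complex.ofReal_zero f).trans hf1) ψ
  rwa [funcCalc_apply_eigenvector hH hc hs hψ, hf5, Complex.ofReal_one, one_smul] at h

theorem eigenproj_apply_spectralProj (hH : IsSelfAdjoint H) {a b e : ℝ} (he : e ∈ Ioo a b)
    (ψ : E) : eigenproj H e (spectralProj H (Ioo a b) ψ) = eigenproj H e ψ := by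
  rw [← sub_eq_zero, ← map_sub, ← inner_self_eq_zero (𝕜 := ℂ), inner_eigenproj,
    ← mul_apply_eq_comp, eigenproj_mul_self, inner_sub_left, spectralProj,
    Submodule.inner_starProjection_left_eq_right, Submodule.starProjection_eq_self_iff.2,
    sub_self]
  exact Submodule.le_topologicalClosure _
    (eigenspace_le_spectralSubspace hH he (eigenproj_apply_mem hH e _))

/-- Bessel's inequality for χ_{(a,b)}(H)ψ. It turns the trace hypothesis on the spectral projection
into a bound for sums of eigenprojections. -/
theorem tsum_Ioo_enorm_eigenproj_sq_le (hH : IsSelfAdjoint H) (a b : ℝ) (ψ : E) :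
    ∑' e : Ioo a b, ‖eigenproj H e ψ‖ₑ ^ 2 ≤ ‖spectralProj H (Ioo a b) ψ‖ₑ ^ 2 := by
  refine le_trans ?_ (tsum_enorm_eigenproj_sq_le hH _)
  refine le_trans (le_of_eq ?_) (ENNReal.tsum_comp_le_tsum_of_injective
    (Subtype.val_injective (p := (· ∈ Ioo a b))) _)
  exact tsum_congr fun e => by simp only [eigenproj_apply_spectralProj hH e.2]

end Eigenprojections

/-! ### Cauchy–Schwarz and Minkowski inequalities in [0, ∞] -/

section ENNRealSums

theorem tsum_mul_sq_le {ι : Type*} (f g : ι → ℝ≥0∞) :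
    (∑' i, f i * g i) ^ 2 ≤ (∑' i, f i ^ 2) * ∑' i, g i ^ 2 := by
  have h : ∑' i, f i * g i ≤ ((∑' i, f i ^ 2) * ∑' i, g i ^ 2) ^ (1 / 2 : ℝ) := by
    rw [ENNReal.tsum_eq_iSup_sum]
    refine iSup_le fun s => (ENNReal.inner_le_Lp_mul_Lq s f g Real.HolderConjugate.two_two).trans ?_
    rw [← ENNReal.mul_rpow_of_nonneg _ _ (by norm_num)]
    simp only [ENNReal.rpow_two]
    gcongr <;> exact ENNReal.sum_le_tsum _
  calc (∑' i, f i * g i) ^ 2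
      ≤ (((∑' i, f i ^ 2) * ∑' i, g i ^ 2) ^ (1 / 2 : ℝ)) ^ 2 := by gcongr
    _ = _ := by rw [← ENNReal.rpow_two, ← ENNReal.rpow_mul]; norm_num

/-- Minkowski's inequality in `ℓ²`, for arbitrary sums. -/
theorem tsum_tsum_sq_le {ι κ : Type*} (f : ι → κ → ℝ≥0∞) (h : κ → ℝ≥0∞)
    (hf : ∀ k, ∑' i, f i k ^ 2 ≤ h k ^ 2) : ∑' i, (∑' k, f i k) ^ 2 ≤ (∑' k, h k) ^ 2 := by
  -- Expand the square, sum over i first, and apply Cauchy–Schwarz to each pair (k, l).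
  calc ∑' i, (∑' k, f i k) ^ 2 = ∑' i, ∑' k, ∑' l, f i k * f i l := by
        refine tsum_congr fun i => ?_
        rw [sq, ← ENNReal.tsum_mul_right]
        exact tsum_congr fun k => ENNReal.tsum_mul_left.symm
    _ = ∑' k, ∑' l, ∑' i, f i k * f i l := by
        rw [ENNReal.tsum_comm]
        exact tsum_congr fun k => ENNReal.tsum_comm
    _ ≤ ∑' k, ∑' l, h k * h l := by
        refine ENNReal.tsum_le_tsum fun k => ENNReal.tsum_le_tsum fun l => ?_
        refine (ENNReal.pow_le_pow_left_iff two_ne_zero).1 ?_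
        rw [mul_pow]
        exact (tsum_mul_sq_le _ _).trans (mul_le_mul' (hf k) (hf l))
    _ = (∑' k, h k) ^ 2 := by
        rw [sq, ← ENNReal.tsum_mul_right]
        exact tsum_congr fun k => ENNReal.tsum_mul_left

theorem enorm_le_tsum_of_hasSum {ι F : Type*} [NormedAddCommGroup F] {f : ι → F} {x : F}
    (h : HasSum f x) : ‖x‖ₑ ≤ ∑' i, ‖f i‖ₑ := by
  have h1 : Filter.Tendsto (fun s : Finset ι => ‖∑ i ∈ s, f i‖ₑ) Filter.atTop (nhds ‖x‖ₑ) :=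
    (continuous_enorm.tendsto x).comp h
  exact le_of_tendsto' h1 fun s => (enorm_sum_le _ _).trans (ENNReal.sum_le_tsum s)

end ENNRealSums

/-! ### The Hilbert–Schmidt norm -/

section HilbertSchmidt

variable {E : Type*} [NormedAddCommGroup E] [InnerProductSpace ℂ E] [CompleteSpace E]

theorem hsNorm_sq (A : E →L[ℂ] E) : hsNorm A ^ 2 = ∑' i, ‖A (basis E i)‖ₑ ^ 2 := by
  rw [hsNorm, ← ENNReal.rpow_two, ← ENNReal.rpow_mul]
  norm_num

omit [CompleteSpace E] in
theorem enorm_sq_eq_tsum_inner {ι : Type*} (b : HilbertBasis ι ℂ E) (x : E) :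
    ‖x‖ₑ ^ 2 = ∑' i, ‖⟪b i, x⟫_ℂ‖ₑ ^ 2 := by
  have h := (Complex.hasSum_iff _ _).1 (b.hasSum_inner_mul_inner x x)
  have h1 : HasSum (fun i => ‖⟪b i, x⟫_ℂ‖ ^ 2) (‖x‖ ^ 2) := by
    convert h.1 using 1
    · ext i
      rw [← inner_conj_symm x, ← Complex.normSq_eq_conj_mul_self, Complex.ofReal_re,
        Complex.normSq_eq_norm_sq]
    · rw [inner_self_eq_norm_sq_to_K]
      norm_cast
  have h2 : ∀ r : ℝ, 0 ≤ r → ENNReal.ofReal r ^ 2 = ENNReal.ofReal (r ^ 2) := fun r hr =>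
    (ENNReal.ofReal_pow hr 2).symm
  simp_rw [← ofReal_norm, h2 _ (norm_nonneg _)]
  rw [← h1.tsum_eq, ENNReal.ofReal_tsum_of_nonneg (fun _ => sq_nonneg _) h1.summable]

theorem hsNorm_sq_eq_tsum_tsum (A : E →L[ℂ] E) :
    hsNorm A ^ 2 = ∑' i, ∑' j, ‖⟪basis E j, A (basis E i)⟫_ℂ‖ₑ ^ 2 := by
  rw [hsNorm_sq]
  exact tsum_congr fun i => enorm_sq_eq_tsum_inner _ _

theorem sq_le_sq_ennreal {a b : ℝ≥0∞} : a ^ 2 ≤ b ^ 2 ↔ a ≤ b :=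
  ENNReal.pow_le_pow_left_iff two_ne_zero

theorem hsNorm_star (A : E →L[ℂ] E) : hsNorm (star A) = hsNorm A := by
  have h : hsNorm (star A) ^ 2 = hsNorm A ^ 2 := by
    rw [hsNorm_sq_eq_tsum_tsum, hsNorm_sq_eq_tsum_tsum, ENNReal.tsum_comm]
    refine tsum_congr fun i => tsum_congr fun j => ?_
    rw [ContinuousLinearMap.star_eq_adjoint, ContinuousLinearMap.adjoint_inner_right,
      ← inner_conj_symm, RCLike.enorm_conj]
  exact le_antisymm (sq_le_sq_ennreal.1 h.le) (sq_le_sq_ennreal.1 h.ge)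

/-- Move A to the basis vectors, ⟨bᵢ, Ax⟩ = ⟨A*bᵢ, x⟩, and use that A and A* have the same
Hilbert–Schmidt norm. -/
theorem enorm_apply_le_hsNorm (A : E →L[ℂ] E) (x : E) : ‖A x‖ₑ ≤ hsNorm A * ‖x‖ₑ := by
  rw [← sq_le_sq_ennreal, mul_pow, enorm_sq_eq_tsum_inner (basis E), ← hsNorm_star, hsNorm_sq,
    ← ENNReal.tsum_mul_right]
  refine ENNReal.tsum_le_tsum fun i => ?_
  rw [← ContinuousLinearMap.adjoint_inner_left, ← ContinuousLinearMap.star_eq_adjoint, ← mul_pow]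
  gcongr
  rw [← ofReal_norm, ← ofReal_norm, ← ofReal_norm, ← ENNReal.ofReal_mul (norm_nonneg _)]
  exact ENNReal.ofReal_le_ofReal (norm_inner_le_norm _ _)

theorem hsNorm_mul_le_of_bound {A : E →L[ℂ] E} {c : ℝ≥0∞} (h : ∀ x, ‖A x‖ₑ ≤ c * ‖x‖ₑ)
    (B : E →L[ℂ] E) : hsNorm (A * B) ≤ c * hsNorm B := by
  rw [← sq_le_sq_ennreal, mul_pow, hsNorm_sq, hsNorm_sq, ← ENNReal.tsum_mul_left]
  refine ENNReal.tsum_le_tsum fun i => ?_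
  rw [← mul_pow]
  gcongr
  exact h _

theorem hsNorm_mul_le (A B : E →L[ℂ] E) : hsNorm (A * B) ≤ hsNorm A * hsNorm B :=
  hsNorm_mul_le_of_bound (enorm_apply_le_hsNorm A) B

/-- Minkowski's inequality from a pointwise bound, so that operator series which converge only
strongly are covered. -/
theorem hsNorm_le_tsum {κ : Type*} {B : E →L[ℂ] E} (w : κ → ℝ≥0∞) (A : κ → E →L[ℂ] E)
    (h : ∀ x, ‖B x‖ₑ ≤ ∑' k, w k * ‖A k x‖ₑ) : hsNorm B ≤ ∑' k, w k * hsNorm (A k) := by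
  rw [← sq_le_sq_ennreal, hsNorm_sq]
  refine le_trans (ENNReal.tsum_le_tsum fun i => pow_le_pow_left' (h _) 2)
    (tsum_tsum_sq_le _ _ fun k => ?_)
  rw [mul_pow, hsNorm_sq, ← ENNReal.tsum_mul_left]
  exact ENNReal.tsum_le_tsum fun i => (mul_pow _ _ _).le

theorem hsNorm_isometry_mul {U : E →L[ℂ] E} (hU : ∀ x, ‖U x‖ = ‖x‖) (A : E →L[ℂ] E) :
    hsNorm (U * A) = hsNorm A := by
  simp only [hsNorm, mul_apply_eq_comp, ← ofReal_norm, hU]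

theorem hsNorm_mul_star_isometry {U : E →L[ℂ] E} (hU : ∀ x, ‖U x‖ = ‖x‖) (A : E →L[ℂ] E) :
    hsNorm (A * star U) = hsNorm A := by
  rw [← hsNorm_star, star_mul, star_star, hsNorm_isometry_mul hU, hsNorm_star]

end HilbertSchmidt

/-! ### Wiener's theorem on time means -/

section Wiener

theorem norm_exp_phase (t a : ℝ) : ‖Complex.exp (-(Complex.I * t * a))‖ = 1 := by
  have : -(Complex.I * t * a) = ((-(t * a) : ℝ) : ℂ) * Complex.I := by push_cast; ring
  rw [this, Complex.norm_exp_ofReal_mul_I]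

theorem norm_mean_le_one {T : ℝ} (hT : 0 < T) (a : ℝ) :
    ‖((T : ℂ)⁻¹ * ∫ t in (0 : ℝ)..T, Complex.exp (-(Complex.I * t * a)))‖ ≤ 1 := by
  rw [norm_mul, norm_inv, Complex.norm_real, Real.norm_of_nonneg hT.le, inv_mul_le_iff₀ hT]
  refine (intervalIntegral.norm_integral_le_of_norm_le_const
    fun t _ => (norm_exp_phase t a).le).trans ?_
  rw [sub_zero, abs_of_pos hT, one_mul, mul_one]

theorem tendsto_mean_exp (a : ℝ) :
    Filter.Tendsto (fun n : ℕ => (((n + 1 : ℝ) : ℂ)⁻¹ *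
      ∫ t in (0 : ℝ)..(n + 1 : ℝ), Complex.exp (-(Complex.I * t * a)))) Filter.atTop
      (nhds (if a = 0 then 1 else 0)) := by
  split_ifs with h
  · subst h
    refine tendsto_const_nhds.congr fun n => ?_
    have h0 : ((n + 1 : ℝ) : ℂ) ≠ 0 := by exact_mod_cast (Nat.cast_add_one_pos (α := ℝ) n).ne'
    simp only [Complex.ofReal_zero, mul_zero, neg_zero, Complex.exp_zero,
      intervalIntegral.integral_const, sub_zero]
    rw [Complex.real_smul, mul_one, inv_mul_cancel₀ h0]
  · have hc : -(Complex.I * a) ≠ 0 := by simpa using h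
    have hb : ∀ n : ℕ, ‖(((n + 1 : ℝ) : ℂ)⁻¹ *
        ∫ t in (0 : ℝ)..(n + 1 : ℝ), Complex.exp (-(Complex.I * t * a)))‖ ≤
        (2 / |a|) * (1 / ((n : ℝ) + 1)) := by
      intro n
      have h1 : (∫ t in (0 : ℝ)..(n + 1 : ℝ), Complex.exp (-(Complex.I * t * a))) =
          ∫ t in (0 : ℝ)..(n + 1 : ℝ), Complex.exp (-(Complex.I * a) * t) := by
        congr 1; ext t; congr 1; ring
      have h2 : ∀ s : ℝ, ‖Complex.exp (-(Complex.I * a) * s)‖ = 1 := fun s => by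
        rw [← norm_exp_phase s a]; congr 2; ring
      have h0 : (0 : ℝ) < n + 1 := by positivity
      rw [h1, integral_exp_mul_complex hc, norm_mul, norm_div, norm_inv, Complex.norm_real,
        Real.norm_of_nonneg h0.le, norm_neg, norm_mul, Complex.norm_I, one_mul,
        Complex.norm_real, Real.norm_eq_abs, mul_comm, one_div]
      refine mul_le_mul_of_nonneg_right ?_ (inv_nonneg.2 h0.le)
      refine div_le_div_of_nonneg_right ?_ (abs_nonneg a)
      refine (norm_sub_le _ _).trans ?_
      rw [h2, h2]; norm_num
    refine squeeze_zero_norm hb ?_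
    simpa using (tendsto_one_div_add_atTop_nhds_zero_nat (𝕜 := ℝ)).const_mul (2 / |a|)

/-- The squared modulus is a double series, absolutely summable because c is in ℓ¹. Average it term
by term: the mean of each phase tends to 0 off the diagonal, and distinct frequencies leave only the
diagonal. Dominated convergence exchanges limit and sum. -/
theorem tendsto_mean_normSq {ι : Type*} [Countable ι] {c : ι → ℂ} (hc : Summable fun i => ‖c i‖)
    {l : ι → ℝ} (hl : Function.Injective l) :
    Filter.Tendsto (fun n : ℕ => (((n + 1 : ℝ) : ℂ)⁻¹ * ∫ t in (0 : ℝ)..(n + 1 : ℝ),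
      ((‖∑' i, Complex.exp (-(Complex.I * t * l i)) * c i‖ ^ 2 : ℝ) : ℂ))) Filter.atTop
      (nhds ((∑' i, ‖c i‖ ^ 2 : ℝ) : ℂ)) := by
  classical
  set g : ι × ι → ℝ → ℂ := fun p t =>
    c p.1 * star (c p.2) * Complex.exp (-(Complex.I * t * ((l p.1 - l p.2 : ℝ) : ℂ))) with hg
  have hcc : Summable fun p : ι × ι => ‖c p.1‖ * ‖c p.2‖ :=
    hc.mul_of_nonneg hc (fun _ => norm_nonneg _) (fun _ => norm_nonneg _)
  have hgn : ∀ p t, ‖g p t‖ = ‖c p.1‖ * ‖c p.2‖ := fun p t => by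
    simp only [hg, norm_mul, norm_star, norm_exp_phase, mul_one]
  have hpt : ∀ t : ℝ, ((‖∑' i, Complex.exp (-(Complex.I * t * l i)) * c i‖ ^ 2 : ℝ) : ℂ) =
      ∑' p, g p t := by
    intro t
    have hs : Summable fun i => ‖Complex.exp (-(Complex.I * t * l i)) * c i‖ := by
      simpa only [norm_mul, norm_exp_phase, one_mul] using hc
    have hs' : Summable fun i => ‖star (Complex.exp (-(Complex.I * t * l i)) * c i)‖ := by
      simpa only [norm_star] using hs
    rw [Complex.ofReal_pow, ← Complex.mul_conj', starRingEnd_apply, tsum_star,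
      tsum_mul_tsum_of_summable_norm hs hs']
    refine tsum_congr fun p => ?_
    have h1 : star (Complex.exp (-(Complex.I * t * l p.2))) =
        Complex.exp (Complex.I * t * l p.2) := by
      rw [← starRingEnd_apply, ← Complex.exp_conj]; simp
    simp only [hg]
    rw [star_mul, h1, Complex.ofReal_sub, mul_sub, neg_sub, sub_eq_add_neg, Complex.exp_add]
    ring
  have hex : ∀ n : ℕ, (((n + 1 : ℝ) : ℂ)⁻¹ * ∫ t in (0 : ℝ)..(n + 1 : ℝ),
      ((‖∑' i, Complex.exp (-(Complex.I * t * l i)) * c i‖ ^ 2 : ℝ) : ℂ)) =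
      ∑' p : ι × ι, c p.1 * star (c p.2) * (((n + 1 : ℝ) : ℂ)⁻¹ * ∫ t in (0 : ℝ)..(n + 1 : ℝ),
        Complex.exp (-(Complex.I * t * ((l p.1 - l p.2 : ℝ) : ℂ)))) := by
    intro n
    have h0 : (0 : ℝ) ≤ n + 1 := by positivity
    simp_rw [hpt, intervalIntegral.integral_of_le h0]
    have hsum := hasSum_integral_of_summable_integral_norm (F := g)
      (μ := volume.restrict (Ioc (0 : ℝ) (n + 1))) (fun p => ?_) ?_
    · rw [← hsum.tsum_eq, ← tsum_mul_left]
      refine tsum_congr fun p => ?_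
      simp only [hg]
      rw [integral_const_mul]
      ring
    · have hcont : Continuous (g p) := by fun_prop
      exact (hcont.integrableOn_Icc).mono_set Ioc_subset_Icc_self
    · simp only [hgn, integral_const]
      exact hcc.const_smul _
  simp_rw [hex]
  have hlim := tendsto_tsum_of_dominated_convergence (𝓕 := Filter.atTop)
    (f := fun (n : ℕ) (p : ι × ι) => c p.1 * star (c p.2) *
      (((n + 1 : ℝ) : ℂ)⁻¹ * ∫ t in (0 : ℝ)..(n + 1 : ℝ),
        Complex.exp (-(Complex.I * t * ((l p.1 - l p.2 : ℝ) : ℂ)))))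
    (g := fun p => c p.1 * star (c p.2) * (if l p.1 - l p.2 = 0 then 1 else 0)) hcc
    (fun p => (tendsto_mean_exp _).const_mul _)
    (Filter.Eventually.of_forall fun n p => by
      rw [norm_mul, norm_mul, norm_star]
      exact mul_le_of_le_one_right (by positivity) (norm_mean_le_one (by positivity) _))
  convert hlim using 2
  have hinj : Function.Injective fun i : ι => (i, i) := fun i j h => (Prod.mk.inj h).1
  rw [← hinj.tsum_eq (f := fun p : ι × ι => c p.1 * star (c p.2) *
    (if l p.1 - l p.2 = 0 then 1 else 0))]
  · rw [Complex.ofReal_tsum]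
    refine tsum_congr fun i => ?_
    rw [sub_self, if_pos rfl, mul_one, ← starRingEnd_apply, Complex.mul_conj']
    norm_cast
  · intro p hp
    by_cases h : l p.1 - l p.2 = 0
    · exact ⟨p.1, Prod.ext rfl (hl (sub_eq_zero.1 h))⟩
    · simp [h] at hp

/-- The mean of `f` over `(0, n + 1]`. -/
def timeMean (f : ℝ → ℝ≥0∞) (n : ℕ) : ℝ≥0∞ :=
  ENNReal.ofReal (1 / (n + 1)) * ∫⁻ t in Ioc (0 : ℝ) (n + 1), f t

/-- Wiener's theorem for an absolutely summable pure point measure. -/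
theorem tendsto_timeMean {c : ℝ → ℂ} (hc : Summable fun e => ‖c e‖) {F : ℝ → ℂ}
    (hF : ∀ t : ℝ, HasSum (fun e : ℝ => Complex.exp (-(Complex.I * t * e)) * c e) (F t)) :
    Filter.Tendsto (timeMean fun t => ‖F t‖ₑ ^ 2) Filter.atTop (nhds (∑' e, ‖c e‖ₑ ^ 2)) := by
  -- The sum runs over all reals; summability restricts it to a countable support, as termwise
  -- integration requires.
  have hcs : Countable (Function.support c) := by
    have := hc.countable_support
    simp only [Function.support, ne_eq, norm_eq_zero] at this
    exact this.to_subtype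
  have h1 := tendsto_mean_normSq (c := fun i : Function.support c => c i) (hc.subtype _)
    Subtype.val_injective
  have h2 : ∀ t : ℝ, ∑' i : Function.support c, Complex.exp (-(Complex.I * t * (i : ℝ))) * c i =
      F t := by
    intro t
    rw [← (hF t).tsum_eq]
    refine tsum_subtype_eq_of_support_subset (f := fun e : ℝ =>
      Complex.exp (-(Complex.I * t * e)) * c e) fun e he => ?_
    exact right_ne_zero_of_mul he
  have h3 : ∑' i : Function.support c, ‖c i‖ ^ 2 = ∑' e, ‖c e‖ ^ 2 := by
    refine tsum_subtype_eq_of_support_subset (f := fun e => ‖c e‖ ^ 2) fun e he => ?_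
    contrapose! he
    simp only [Function.mem_support, not_not] at he ⊢
    simp [he]
  simp_rw [h2, h3] at h1
  have hFc : Continuous F := by
    have : F = fun t : ℝ => ∑' e : ℝ, Complex.exp (-(Complex.I * t * e)) * c e :=
      funext fun t => (hF t).tsum_eq.symm
    rw [this]
    refine continuous_tsum (fun e => by fun_prop) hc fun e t => ?_
    rw [norm_mul, norm_exp_phase, one_mul]
  have hsq : Summable fun e => ‖c e‖ ^ 2 := by
    refine Summable.of_nonneg_of_le (fun _ => sq_nonneg _) (fun e => ?_)
      (hc.mul_left (∑' e, ‖c e‖))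
    rw [sq]
    exact mul_le_mul_of_nonneg_right (hc.le_tsum e fun _ _ => norm_nonneg _) (norm_nonneg _)
  have h4 := ENNReal.tendsto_ofReal ((Complex.continuous_re.tendsto _).comp h1)
  rw [Complex.ofReal_re, ENNReal.ofReal_tsum_of_nonneg (fun _ => sq_nonneg _) hsq] at h4
  convert h4 using 2 with n
  · have h0 : (0 : ℝ) ≤ n + 1 := by positivity
    simp only [Function.comp, timeMean]
    rw [intervalIntegral.integral_ofReal, ← Complex.ofReal_inv, ← Complex.ofReal_mul,
      Complex.ofReal_re, ENNReal.ofReal_mul (by positivity), one_div,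
      intervalIntegral.integral_of_le h0, ofReal_integral_eq_lintegral_ofReal]
    · simp_rw [ENNReal.ofReal_pow (norm_nonneg _), ofReal_norm]
    · exact ((hFc.norm.pow 2).integrableOn_Icc).mono_set Ioc_subset_Icc_self
    · exact Filter.Eventually.of_forall fun _ => sq_nonneg _
  · refine tsum_congr fun e => ?_
    rw [ENNReal.ofReal_pow (norm_nonneg _), ofReal_norm]

end Wiener

/-! ### Measurability of functions of a random operator -/

section Measurability

variable {E : Type*} [NormedAddCommGroup E] [InnerProductSpace ℂ E] [CompleteSpace E]

/-- Orthonormal vectors are at distance √2 > 1, so balls of radius 1/2 around them are disjoint. -/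
theorem countable_basisIndex [TopologicalSpace.SeparableSpace E] : Countable (basisIndex E) := by
  have hd : (univ : Set (basisIndex E)).PairwiseDisjoint
      fun i => Metric.ball (basis E i) (1 / 2) := by
    intro i _ j _ hij
    refine Metric.ball_disjoint_ball ?_
    have h := (basis E).orthonormal
    have h2 : ‖basis E i - basis E j‖ ^ 2 = 2 := by
      rw [@norm_sub_sq ℂ, h.1 i, h.1 j, h.2 hij]; norm_num
    rw [dist_eq_norm]
    nlinarith [norm_nonneg (basis E i - basis E j)]
  have := hd.countable_of_isOpen (fun _ _ => Metric.isOpen_ball)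
    fun i _ => ⟨basis E i, Metric.mem_ball_self (by norm_num)⟩
  exact countable_univ_iff.1 this

variable {Ω : Type*} [MeasurableSpace Ω]

/-- Weak measurability of a family of bounded operators. -/
def WeaklyMeasurable (A : Ω → E →L[ℂ] E) : Prop :=
  ∀ φ ψ : E, Measurable fun ω => ⟪φ, A ω ψ⟫_ℂ

omit [CompleteSpace E] in
theorem WeaklyMeasurable.const (A : E →L[ℂ] E) : WeaklyMeasurable fun _ : Ω => A :=
  fun _ _ => measurable_const

omit [CompleteSpace E] in
theorem WeaklyMeasurable.add {A B : Ω → E →L[ℂ] E} (hA : WeaklyMeasurable A)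
    (hB : WeaklyMeasurable B) : WeaklyMeasurable fun ω => A ω + B ω := fun φ ψ => by
  simp only [add_apply, inner_add_right]
  exact (hA φ ψ).add (hB φ ψ)

omit [CompleteSpace E] in
theorem WeaklyMeasurable.const_smul {A : Ω → E →L[ℂ] E} (hA : WeaklyMeasurable A) (c : ℂ) :
    WeaklyMeasurable fun ω => c • A ω := fun φ ψ => by
  simpa only [smul_apply, inner_smul_right] using (hA φ ψ).const_mul c

theorem WeaklyMeasurable.star {A : Ω → E →L[ℂ] E} (hA : WeaklyMeasurable A) :
    WeaklyMeasurable fun ω => star (A ω) := fun φ ψ => by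
  have h : ∀ ω, ⟪φ, (Star.star (A ω)) ψ⟫_ℂ = Star.star ⟪ψ, A ω φ⟫_ℂ := fun ω => by
    rw [ContinuousLinearMap.star_eq_adjoint, ContinuousLinearMap.adjoint_inner_right,
      ← inner_conj_symm]; rfl
  simp only [h]
  exact continuous_star.measurable.comp (hA ψ φ)

theorem WeaklyMeasurable.mul [TopologicalSpace.SeparableSpace E] {A B : Ω → E →L[ℂ] E}
    (hA : WeaklyMeasurable A) (hB : WeaklyMeasurable B) :
    WeaklyMeasurable fun ω => A ω * B ω := fun φ ψ => by
  have := countable_basisIndex (E := E)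
  have h : ∀ ω, ⟪φ, (A ω * B ω) ψ⟫_ℂ =
      ∑' i, ⟪φ, A ω (basis E i)⟫_ℂ * ⟪basis E i, B ω ψ⟫_ℂ := fun ω => by
    rw [mul_apply_eq_comp, ← ContinuousLinearMap.adjoint_inner_left,
      ← ((basis E).hasSum_inner_mul_inner _ _).tsum_eq]
    exact tsum_congr fun i => by rw [ContinuousLinearMap.adjoint_inner_left]
  have hs : ∀ ω, Summable fun i => ⟪φ, A ω (basis E i)⟫_ℂ * ⟪basis E i, B ω ψ⟫_ℂ := fun ω => by
    have := ((basis E).hasSum_inner_mul_inner (ContinuousLinearMap.adjoint (A ω) φ)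
      (B ω ψ)).summable
    simpa only [ContinuousLinearMap.adjoint_inner_left] using this
  have hm : ∀ s : Finset (basisIndex E), Measurable fun ω =>
      ∑ i ∈ s, ⟪φ, A ω (basis E i)⟫_ℂ * ⟪basis E i, B ω ψ⟫_ℂ := fun s =>
    Finset.measurable_fun_sum s fun i _ => (hA _ _).mul (hB _ _)
  refine measurable_of_tendsto_metrizable' Filter.atTop hm ?_
  rw [tendsto_pi_nhds]
  intro ω
  rw [h ω]
  exact (hs ω).hasSum

omit [CompleteSpace E] in
theorem WeaklyMeasurable.of_tendsto {A : ℕ → Ω → E →L[ℂ] E} {B : Ω → E →L[ℂ] E}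
    (hA : ∀ n, WeaklyMeasurable (A n))
    (h : ∀ ω, Filter.Tendsto (fun n => A n ω) Filter.atTop (nhds (B ω))) :
    WeaklyMeasurable B := fun φ ψ => by
  refine measurable_of_tendsto_metrizable (fun n => hA n φ ψ) ?_
  rw [tendsto_pi_nhds]
  intro ω
  exact Filter.Tendsto.inner tendsto_const_nhds
    (((ContinuousLinearMap.apply ℂ E ψ).continuous.tendsto _).comp (h ω))

/-- The spectrum varies with ω, so all calculi are pulled back to the fixed algebra of continuous
functions on the circle. There Stone–Weierstrass applies: weak measurability survives sums,
products, adjoints and limits. -/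
theorem WeaklyMeasurable.cfc [TopologicalSpace.SeparableSpace E] {U : Ω → E →L[ℂ] E}
    (hU : WeaklyMeasurable U) (hu : ∀ ω, U ω ∈ unitary (E →L[ℂ] E)) {g : ℂ → ℂ}
    (hg : ContinuousOn g (Metric.sphere 0 1)) : WeaklyMeasurable fun ω => cfc g (U ω) := by
  have hn : ∀ ω, IsStarNormal (U ω) := fun ω =>
    ⟨by rw [Commute, SemiconjBy, (hu ω).1, (hu ω).2]⟩
  have hsub : ∀ ω, spectrum ℂ (U ω) ⊆ Metric.sphere (0 : ℂ) 1 := fun ω =>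
    spectrum.subset_circle_of_unitary (hu ω)
  let ι : ∀ ω, C(spectrum ℂ (U ω), Metric.sphere (0 : ℂ) 1) := fun ω =>
    ⟨Set.inclusion (hsub ω), continuous_inclusion (hsub ω)⟩
  let Φ : ∀ ω, C(Metric.sphere (0 : ℂ) 1, ℂ) →⋆ₐ[ℂ] (E →L[ℂ] E) := fun ω =>
    (cfcHom (hn ω)).comp (ContinuousMap.compStarAlgHom' ℂ ℂ (ι ω))
  have hΦ : ∀ ω, Continuous (Φ ω) := fun ω =>
    (cfcHom_continuous (hn ω)).comp (ContinuousMap.continuous_precomp (ι ω))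
  have hid : ∀ ω, Φ ω (ContinuousMap.restrict (Metric.sphere (0 : ℂ) 1) (.id ℂ)) = U ω :=
    fun ω => cfcHom_id (hn ω)
  have key : ∀ k : C(Metric.sphere (0 : ℂ) 1, ℂ), WeaklyMeasurable fun ω => Φ ω k := by
    intro k
    induction k using ContinuousMap.induction_on_of_compact with
    | const r =>
      have : ContinuousMap.const (Metric.sphere (0 : ℂ) 1) r =
        algebraMap ℂ C(Metric.sphere (0 : ℂ) 1, ℂ) r := rfl
      simp only [this, AlgHomClass.commutes]
      exact .const _
    | id => simpa only [hid] using hU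
    | star_id => simpa only [map_star, hid] using hU.star
    | add f g hf hg => simpa only [map_add] using hf.add hg
    | mul f g hf hg => simpa only [map_mul] using hf.mul hg
    | frequently f hf =>
      obtain ⟨u, hu1, hu2⟩ := mem_closure_iff_seq_limit.1 (mem_closure_iff_frequently.2 hf)
      exact .of_tendsto hu1 fun ω => ((hΦ ω).tendsto _).comp hu2
  have := key ⟨_, continuousOn_iff_continuous_domRestrict.1 hg⟩
  convert this using 2 with ω
  rw [cfc_apply g (U ω) (hn ω) (hg.mono (hsub ω))]
  rfl

theorem WeaklyMeasurable.funcCalc [TopologicalSpace.SeparableSpace E] {H : Ω → E →ₗ.[ℂ] E}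
    (hH : ∀ ω, IsSelfAdjoint (H ω))
    (hm : WeaklyMeasurable fun ω => resolventOp (H ω) (-Complex.I)) {f : ℝ → ℂ}
    (hf : Continuous f) (hc : HasCompactSupport f) :
    WeaklyMeasurable fun ω => funcCalc (H ω) f := by
  refine WeaklyMeasurable.cfc ?_ (fun ω => cayley_mem_unitary (hH ω))
    (continuousOn_cayleySymbol hf hc)
  have := (WeaklyMeasurable.const (1 : E →L[ℂ] E)).add (hm.const_smul (-(2 * Complex.I)))
  simpa only [cayley, sub_eq_add_neg, neg_smul] using this

theorem continuous_evolutionSymbol {X : ℝ → ℝ} (hX : Continuous X) (t : ℝ) :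
    Continuous fun l : ℝ => Complex.exp (-(Complex.I * t * l)) * (X l : ℂ) := by
  fun_prop

theorem support_evolutionSymbol (X : ℝ → ℝ) (t : ℝ) :
    (Function.support fun l : ℝ => Complex.exp (-(Complex.I * t * l)) * (X l : ℂ)) =
      Function.support X := by
  ext l; simp

theorem tsupport_evolutionSymbol (X : ℝ → ℝ) (t : ℝ) :
    (tsupport fun l : ℝ => Complex.exp (-(Complex.I * t * l)) * (X l : ℂ)) = tsupport X := by
  rw [tsupport, support_evolutionSymbol, tsupport]

theorem hasCompactSupport_evolutionSymbol {X : ℝ → ℝ} (hX : HasCompactSupport X) (t : ℝ) :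
    HasCompactSupport fun l : ℝ => Complex.exp (-(Complex.I * t * l)) * (X l : ℂ) := by
  rw [HasCompactSupport, tsupport_evolutionSymbol]
  exact hX

/-- Lipschitz in norm, with constant sup |l 𝒳(l)|, finite by compact support. Continuity in t with
measurability in ω then gives joint measurability. -/
theorem continuous_evolution {H : E →ₗ.[ℂ] E} (hH : IsSelfAdjoint H) {X : ℝ → ℝ}
    (hX : Continuous X) (hc : HasCompactSupport X) : Continuous (evolution H X) := by
  obtain ⟨M, hM⟩ := (hc.mul_left (f := fun l : ℝ => l)).exists_bound_of_continuous
    (continuous_id.mul hX)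
  have hM0 : 0 ≤ M := (norm_nonneg _).trans (hM 0)
  refine LipschitzWith.continuous (K := ⟨M, hM0⟩) (LipschitzWith.of_dist_le_mul fun t s => ?_)
  rw [dist_eq_norm, dist_eq_norm]
  refine norm_funcCalc_sub_le hH (continuous_evolutionSymbol hX t)
    (hasCompactSupport_evolutionSymbol hc t) (continuous_evolutionSymbol hX s)
    (hasCompactSupport_evolutionSymbol hc s) (mul_nonneg hM0 (norm_nonneg _)) fun l => ?_
  have h1 : Complex.exp (-(Complex.I * t * l)) * (X l : ℂ) -
      Complex.exp (-(Complex.I * s * l)) * (X l : ℂ) = Complex.exp (-(Complex.I * s * l)) *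
      ((Complex.exp (Complex.I * ((-((t - s) * l) : ℝ) : ℂ)) - 1) * X l) := by
    have : -(Complex.I * t * l) = -(Complex.I * s * l) +
      Complex.I * ((-((t - s) * l) : ℝ) : ℂ) := by push_cast; ring
    rw [this, Complex.exp_add]; ring
  rw [h1, norm_mul, norm_exp_phase, one_mul, norm_mul, Complex.norm_real]
  calc _ ≤ ‖-((t - s) * l)‖ * ‖X l‖ := by
        gcongr
        exact Real.norm_exp_I_mul_ofReal_sub_one_le
    _ = ‖l * X l‖ * ‖t - s‖ := by rw [norm_neg, norm_mul, norm_mul]; ring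
    _ ≤ _ := mul_le_mul_of_nonneg_right (hM l) (norm_nonneg _)

theorem measurable_inner_evolution [TopologicalSpace.SeparableSpace E] {H : Ω → E →ₗ.[ℂ] E}
    (hH : ∀ ω, IsSelfAdjoint (H ω))
    (hm : WeaklyMeasurable fun ω => resolventOp (H ω) (-Complex.I)) {X : ℝ → ℝ}
    (hX : Continuous X) (hc : HasCompactSupport X) (φ ψ : E) :
    Measurable fun p : ℝ × Ω => ⟪φ, evolution (H p.2) X p.1 ψ⟫_ℂ := by
  refine measurable_uncurry_of_continuous_of_measurable
    (u := fun (t : ℝ) (ω : Ω) => ⟪φ, evolution (H ω) X t ψ⟫_ℂ) (fun ω => ?_) fun t => ?_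
  · exact continuous_const.inner ((ContinuousLinearMap.apply ℂ E ψ).continuous.comp
      (continuous_evolution (hH ω) hX hc))
  · exact WeaklyMeasurable.funcCalc hH hm (continuous_evolutionSymbol hX t)
      (hasCompactSupport_evolutionSymbol hc t) φ ψ

theorem measurable_hsNorm_evolution [TopologicalSpace.SeparableSpace E] {H : Ω → E →ₗ.[ℂ] E}
    (hH : ∀ ω, IsSelfAdjoint (H ω))
    (hm : WeaklyMeasurable fun ω => resolventOp (H ω) (-Complex.I)) {X : ℝ → ℝ}
    (hX : Continuous X) (hc : HasCompactSupport X) (A B : E →L[ℂ] E) :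
    Measurable fun p : ℝ × Ω => hsNorm (A * evolution (H p.2) X p.1 * B) ^ 2 := by
  have := countable_basisIndex (E := E)
  simp only [hsNorm_sq_eq_tsum_tsum, mul_apply_eq_comp, ← ContinuousLinearMap.adjoint_inner_left A]
  exact Measurable.tsum fun i => Measurable.tsum fun j =>
    (measurable_inner_evolution hH hm hX hc _ _).enorm.pow_const 2

end Measurability

/-! ### Decomposition of the configuration space into unit boxes -/

section Boxes

variable {d : ℕ} {ν : Measure (Fin d → ℝ)}

theorem mem_box_iff {x : Fin d → ℤ} {y : Fin d → ℝ} :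
    y ∈ box x ↔ ∀ i, |y i - x i| < 1 / 2 := by
  rw [box, Metric.mem_ball, dist_pi_lt_iff (by norm_num)]
  rfl

theorem measurableSet_box (x : Fin d → ℤ) : MeasurableSet (box x) :=
  Metric.isOpen_ball.measurableSet

theorem pairwise_disjoint_box : Pairwise (Function.onFun Disjoint (box (d := d))) := by
  intro x x' hne
  rw [Function.onFun, Set.disjoint_left]
  intro y hy hy'
  refine hne (funext fun i => ?_)
  have h1 := abs_lt.1 (mem_box_iff.1 hy i)
  have h2 := abs_lt.1 (mem_box_iff.1 hy' i)
  have h3 : ((x i : ℤ) : ℝ) < x' i + 1 := by linarith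
  have h4 : ((x' i : ℤ) : ℝ) < x i + 1 := by linarith
  have h3' : x i < x' i + 1 := by exact_mod_cast h3
  have h4' : x' i < x i + 1 := by exact_mod_cast h4
  omega

theorem ae_latticeMeasure {p : (Fin d → ℝ) → Prop} :
    (∀ᵐ y ∂latticeMeasure d, p y) ↔ ∀ a, p (latticePt a) := by
  rw [latticeMeasure, Measure.ae_sum_iff]
  simp [ae_dirac_eq]

theorem latticePt_mem_box (a : Fin d → ℤ) : latticePt a ∈ box a :=
  Metric.mem_ball_self (by norm_num)

/-- Open boxes miss only the hyperplanes with a coordinate in ℤ + 1/2, which are Lebesgue null; the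
counting measure lives on the centres. -/
theorem ae_exists_mem_box (hν : ν = volume ∨ ν = latticeMeasure d) :
    ∀ᵐ y ∂ν, ∃ x, y ∈ box x := by
  rcases hν with rfl | rfl
  · have h : ∀ᵐ y : Fin d → ℝ, ∀ (i : Fin d) (n : ℤ), y i ≠ n + 1 / 2 := by
      rw [ae_all_iff]; intro i
      rw [ae_all_iff]; intro n
      exact compl_mem_ae_iff.2
        (Measure.pi_hyperplane (fun _ => (volume : Measure ℝ)) i ((n : ℝ) + 1 / 2))
    filter_upwards [h] with y hy
    refine ⟨fun i => round (y i), mem_box_iff.2 fun i => ?_⟩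
    refine lt_of_le_of_ne (abs_sub_round (y i)) fun heq => ?_
    rcases abs_choice (y i - round (y i)) with h1 | h1
    · rw [h1] at heq
      exact hy i (round (y i)) (by linarith)
    · rw [h1] at heq
      refine hy i (round (y i) - 1) ?_
      push_cast; linarith
  · exact ae_latticeMeasure.2 fun a => ⟨a, latticePt_mem_box a⟩

theorem lintegral_eq_tsum_box (hν : ν = volume ∨ ν = latticeMeasure d)
    (f : (Fin d → ℝ) → ℝ≥0∞) : ∫⁻ y, f y ∂ν = ∑' x, ∫⁻ y in box x, f y ∂ν := by
  rw [← lintegral_iUnion measurableSet_box pairwise_disjoint_box,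
    Measure.restrict_eq_self_of_ae_mem]
  filter_upwards [ae_exists_mem_box hν] with y hy
  exact mem_iUnion.2 hy

theorem L2.enorm_sq (ψ : L2 ν) : ‖ψ‖ₑ ^ 2 = ∫⁻ y, ‖ψ y‖ₑ ^ 2 ∂ν := by
  have h := eLpNorm_nnreal_pow_eq_lintegral (μ := ν) (f := ψ) (p := 2) two_ne_zero
  rw [Lp.enorm_def]
  simpa using h

theorem chi_apply_ae (x : Fin d → ℤ) (ψ : L2 ν) :
    chi ν x ψ =ᵐ[ν] (box x).indicator ψ :=
  MemLp.coeFn_toLp (memLp_indicator_box x ψ)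

theorem enorm_chi_sq (x : Fin d → ℤ) (ψ : L2 ν) :
    ‖chi ν x ψ‖ₑ ^ 2 = ∫⁻ y in box x, ‖ψ y‖ₑ ^ 2 ∂ν := by
  rw [L2.enorm_sq, ← lintegral_indicator (measurableSet_box x)]
  refine lintegral_congr_ae ?_
  filter_upwards [chi_apply_ae x ψ] with y hy
  rw [hy]
  by_cases h : y ∈ box x <;> simp [h]

theorem norm_chi_le (x : Fin d → ℤ) (ψ : L2 ν) : ‖chi ν x ψ‖ ≤ ‖ψ‖ :=
  (norm_chiLin_le ν x ψ).trans_eq (one_mul _)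

theorem chi_mul_self (x : Fin d → ℤ) : chi ν x * chi ν x = chi ν x := by
  ext1 ψ
  refine Lp.ext ?_
  filter_upwards [chi_apply_ae x (chi ν x ψ), chi_apply_ae x ψ] with y h1 h2
  rw [mul_apply_eq_comp, h1, h2]
  by_cases h : y ∈ box x <;> simp [h, h2]

theorem inner_chi (x : Fin d → ℤ) (φ ψ : L2 ν) : ⟪chi ν x φ, ψ⟫_ℂ = ⟪φ, chi ν x ψ⟫_ℂ := by
  rw [MeasureTheory.L2.inner_def, MeasureTheory.L2.inner_def]
  refine integral_congr_ae ?_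
  filter_upwards [chi_apply_ae x φ, chi_apply_ae x ψ] with y h1 h2
  rw [h1, h2]
  by_cases h : y ∈ box x <;> simp [h]

theorem star_chi (x : Fin d → ℤ) : star (chi ν x) = chi ν x := by
  rw [ContinuousLinearMap.star_eq_adjoint, eq_comm, ContinuousLinearMap.eq_adjoint_iff]
  exact inner_chi x

theorem chi_mul_of_ne {x x' : Fin d → ℤ} (h : x ≠ x') : chi ν x * chi ν x' = 0 := by
  ext1 ψ
  refine Lp.ext ?_
  filter_upwards [chi_apply_ae x (chi ν x' ψ), chi_apply_ae x' ψ, Lp.coeFn_zero ℂ 2 ν]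
    with y h1 h2 h3
  rw [mul_apply_eq_comp, h1, zero_apply, h3]
  by_cases hy : y ∈ box x
  · have := Set.disjoint_left.1 (pairwise_disjoint_box h) hy
    simp [hy, h2, this]
  · simp [hy]

theorem enorm_sq_eq_tsum_chi (hν : ν = volume ∨ ν = latticeMeasure d) (ψ : L2 ν) :
    ‖ψ‖ₑ ^ 2 = ∑' x, ‖chi ν x ψ‖ₑ ^ 2 := by
  simp_rw [enorm_chi_sq]
  rw [L2.enorm_sq, lintegral_eq_tsum_box hν]

/-- The series converges by orthogonality, and every χ_v annihilates the remainder, which is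
therefore 0. -/
theorem hasSum_chi (hν : ν = volume ∨ ν = latticeMeasure d) (ψ : L2 ν) :
    HasSum (fun x => chi ν x ψ) ψ := by
  have hV : OrthogonalFamily ℂ (fun x : Fin d → ℤ => (chi ν x).range)
      fun x => ((chi ν x).range).subtypeₗᵢ := by
    rintro x x' hne ⟨_, φ, rfl⟩ ⟨_, ψ, rfl⟩
    change ⟪chi ν x φ, chi ν x' ψ⟫_ℂ = 0
    rw [inner_chi, ← mul_apply_eq_comp, chi_mul_of_ne hne, zero_apply, inner_zero_right]
  have hs : Summable fun x => chi ν x ψ := by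
    refine (hV.summable_iff_norm_sq_summable fun x => ⟨chi ν x ψ, ψ, rfl⟩).2 ?_
    change Summable fun x => ‖chi ν x ψ‖ ^ 2
    have h1 := enorm_sq_eq_tsum_chi hν ψ
    have h2 : ∑' x, ‖chi ν x ψ‖ₑ ^ 2 ≠ ∞ := by
      rw [← h1]; exact ENNReal.pow_ne_top enorm_ne_top
    simpa using ENNReal.summable_toReal h2
  have h0 : ∀ v, chi ν v (ψ - ∑' x, chi ν x ψ) = 0 := fun v => by
    rw [map_sub, ContinuousLinearMap.map_tsum _ hs, sub_eq_zero, tsum_eq_single v fun x hx => by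
      rw [← mul_apply_eq_comp, chi_mul_of_ne hx.symm, zero_apply], ← mul_apply_eq_comp,
      chi_mul_self]
  have h3 := enorm_sq_eq_tsum_chi hν (ψ - ∑' x, chi ν x ψ)
  simp only [h0, enorm_zero, ne_eq, OfNat.ofNat_ne_zero, not_false_eq_true, zero_pow,
    tsum_zero, pow_eq_zero_iff, enorm_eq_zero, sub_eq_zero] at h3
  exact (congrArg (HasSum _) h3).mpr hs.hasSum

theorem separableSpace_L2 (hν : ν = volume ∨ ν = latticeMeasure d) :
    TopologicalSpace.SeparableSpace (L2 ν) := by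
  have : Fact ((2 : ℝ≥0∞) ≠ ⊤) := ⟨by norm_num⟩
  rcases hν with rfl | rfl
  · infer_instance
  · have : SFinite (latticeMeasure d) := by unfold latticeMeasure; infer_instance
    infer_instance

theorem latticeMeasure_restrict_box (u : Fin d → ℤ) :
    (latticeMeasure d).restrict (box u) = Measure.dirac (latticePt u) := by
  ext s hs
  rw [Measure.restrict_apply hs, latticeMeasure,
    Measure.sum_apply _ (hs.inter (measurableSet_box u)), tsum_eq_single u]
  · rw [Measure.dirac_apply' _ (hs.inter (measurableSet_box u)), Measure.dirac_apply' _ hs]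
    by_cases h : latticePt u ∈ s <;> simp [h, latticePt_mem_box]
  · intro a ha
    have := Set.disjoint_left.1 (pairwise_disjoint_box ha) (latticePt_mem_box a)
    rw [Measure.dirac_apply' _ (hs.inter (measurableSet_box u))]
    simp [this]

/-- On the lattice χ_u is the rank-one projection onto a unit vector δ, so the norm equals ‖Aδ‖.
This supplies the trace bound for ℓ²(ℤ^d). -/
theorem hsNorm_mul_chi_le_one {A : L2 (latticeMeasure d) →L[ℂ] L2 (latticeMeasure d)}
    (hA : ∀ ψ, ‖A ψ‖ ≤ ‖ψ‖) (u : Fin d → ℤ) :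
    hsNorm (A * chi (latticeMeasure d) u) ≤ 1 := by
  have hμ : (latticeMeasure d) (box u) = 1 := by
    rw [← Measure.restrict_apply_univ, latticeMeasure_restrict_box, measure_univ]
  have hμ' : (latticeMeasure d) (box u) ≠ ∞ := by simp [hμ]
  set δ : L2 (latticeMeasure d) := indicatorConstLp 2 (measurableSet_box u) hμ' (1 : ℂ) with hδ
  have hδn : ‖δ‖ = 1 := by
    rw [hδ, norm_indicatorConstLp (by norm_num) (by norm_num), Measure.real, hμ]
    simp
  have hchi : ∀ ψ, chi (latticeMeasure d) u ψ = ⟪δ, ψ⟫_ℂ • δ := by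
    intro ψ
    have h1 : ⟪δ, ψ⟫_ℂ = ψ (latticePt u) := by
      rw [hδ, MeasureTheory.L2.inner_indicatorConstLp_one, latticeMeasure_restrict_box,
        integral_dirac]
    refine Lp.ext ?_
    filter_upwards [chi_apply_ae u ψ, Lp.coeFn_smul ⟪δ, ψ⟫_ℂ δ,
      indicatorConstLp_coeFn (p := 2) (hs := measurableSet_box u) (hμs := hμ') (c := (1 : ℂ)),
      ae_latticeMeasure (p := fun y => ∃ b : Fin d → ℤ, y = latticePt b) |>.2
        fun a => ⟨a, rfl⟩] with y h2 h3 h4 h5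
    obtain ⟨a, rfl⟩ := h5
    rw [h2, h3, Pi.smul_apply, hδ, h4, ← hδ, h1]
    by_cases hau : a = u
    · subst hau
      simp [latticePt_mem_box]
    · have := Set.disjoint_left.1 (pairwise_disjoint_box hau) (latticePt_mem_box a)
      simp [this]
  rw [← sq_le_sq_ennreal, hsNorm_sq]
  have h6 : ∀ i, ‖(A * chi (latticeMeasure d) u) (basis (L2 (latticeMeasure d)) i)‖ₑ ^ 2 =
      ‖⟪basis (L2 (latticeMeasure d)) i, δ⟫_ℂ‖ₑ ^ 2 * ‖A δ‖ₑ ^ 2 := fun i => by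
    rw [mul_apply_eq_comp, hchi, map_smul, enorm_smul, mul_pow, ← inner_conj_symm,
      RCLike.enorm_conj]
  simp_rw [h6]
  rw [ENNReal.tsum_mul_right, ← enorm_sq_eq_tsum_inner, ← mul_pow]
  gcongr
  have h7 : ‖δ‖ₑ = 1 := by rw [← ofReal_norm, hδn, ENNReal.ofReal_one]
  rw [h7, one_mul, ← h7, ← ofReal_norm, ← ofReal_norm]
  exact ENNReal.ofReal_le_ofReal (hA δ)

end Boxes

/-! ### Translation covariance of the kernels -/

section Covariance

variable {E : Type*} [NormedAddCommGroup E] [InnerProductSpace ℂ E] [CompleteSpace E]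

theorem hsNorm_eq_of_intertwine {T : E →ₗᵢ[ℂ] E} (hT : Function.Surjective T)
    {B B' : E →L[ℂ] E} (h : ∀ ψ, B' (T ψ) = T (B ψ)) : hsNorm B' = hsNorm B := by
  set U : E →L[ℂ] E := T.toContinuousLinearMap with hU
  have hn : ∀ x, ‖U x‖ = ‖x‖ := T.norm_map
  have h1 : star U * U = 1 := (ContinuousLinearMap.norm_map_iff_adjoint_comp_self U).1 hn
  have h2 : B' = U * B * star U := by
    ext ξ
    obtain ⟨ψ, rfl⟩ := hT ξ
    have h3 : (star U) (T ψ) = ψ := congrArg (fun A : E →L[ℂ] E => A ψ) h1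
    rw [mul_apply_eq_comp, mul_apply_eq_comp, h3, h]
    rfl
  rw [h2, hsNorm_mul_star_isometry hn, hsNorm_isometry_mul hn]

variable {d : ℕ} {ν : Measure (Fin d → ℝ)} (hν : ν = volume ∨ ν = latticeMeasure d)

theorem translation_apply_ae (a : Fin d → ℤ) (ψ : L2 ν) :
    translation hν a ψ =ᵐ[ν] fun y => ψ (y - latticePt a) :=
  Lp.coeFn_compMeasurePreserving ψ (measurePreserving_sub hν a)

theorem translation_translation_neg (a : Fin d → ℤ) (ψ : L2 ν) :
    translation hν a (translation hν (-a) ψ) = ψ := by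
  refine Lp.ext ?_
  have h1 := (measurePreserving_sub hν a).quasiMeasurePreserving.ae_eq_comp
    (translation_apply_ae hν (-a) ψ)
  filter_upwards [translation_apply_ae hν a (translation hν (-a) ψ), h1] with y h2 h3
  rw [h2]
  simp only [Function.comp_apply] at h3
  rw [h3]
  congr 1
  ext i
  simp [latticePt]

theorem translation_surjective (a : Fin d → ℤ) : Function.Surjective (translation hν a) :=
  fun ψ => ⟨_, translation_translation_neg hν a ψ⟩

theorem sub_latticePt_mem_box {a x : Fin d → ℤ} {y : Fin d → ℝ} :
    y - latticePt a ∈ box x ↔ y ∈ box (x + a) := by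
  simp only [mem_box_iff, Pi.sub_apply, Pi.add_apply, latticePt]
  refine forall_congr' fun i => ?_
  push_cast
  rw [sub_sub, add_comm]

theorem chi_translation (a x : Fin d → ℤ) (ψ : L2 ν) :
    chi ν (x + a) (translation hν a ψ) = translation hν a (chi ν x ψ) := by
  refine Lp.ext ?_
  have h1 := (measurePreserving_sub hν a).quasiMeasurePreserving.ae_eq_comp (chi_apply_ae x ψ)
  filter_upwards [chi_apply_ae (x + a) (translation hν a ψ), translation_apply_ae hν a ψ,
    translation_apply_ae hν a (chi ν x ψ), h1] with y h2 h3 h4 h5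
  simp only [Function.comp_apply] at h5
  rw [h2, h4, h5]
  by_cases h : y ∈ box (x + a)
  · rw [Set.indicator_of_mem h, Set.indicator_of_mem (sub_latticePt_mem_box.2 h), h3]
  · rw [Set.indicator_of_notMem h, Set.indicator_of_notMem (mt sub_latticePt_mem_box.1 h)]

variable {Ω : Type*} [MeasurableSpace Ω] [AddAction (Fin d → ℤ) Ω] {H : Ω → L2 ν →ₗ.[ℂ] L2 ν}

theorem IsCovariantOperator.mem_eigenspace_iff (hH : IsCovariantOperator hν H) (a : Fin d → ℤ)
    (ω : Ω) (e : ℝ) (ψ : L2 ν) :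
    translation hν a ψ ∈ eigenspace (H (a +ᵥ ω)) e ↔ ψ ∈ eigenspace (H ω) e := by
  rw [mem_eigenspace, mem_eigenspace, ← map_smul]
  exact (hH.covariant a ω ψ _).symm

theorem IsCovariantOperator.eigenproj_translation (hH : IsCovariantOperator hν H)
    (a : Fin d → ℤ) (ω : Ω) (e : ℝ) (ψ : L2 ν) :
    eigenproj (H (a +ᵥ ω)) e (translation hν a ψ) =
      translation hν a (eigenproj (H ω) e ψ) := by
  have h1 : eigenproj (H (a +ᵥ ω)) e (translation hν a (eigenproj (H ω) e ψ)) =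
      translation hν a (eigenproj (H ω) e ψ) :=
    eigenproj_apply_of_mem ((hH.mem_eigenspace_iff hν a ω e _).2
      (eigenproj_apply_mem (hH.selfAdjoint ω) e ψ))
  rw [← h1, ← sub_eq_zero, ← map_sub, ← map_sub, ← inner_self_eq_zero (𝕜 := ℂ),
    inner_eigenproj, ← mul_apply_eq_comp, eigenproj_mul_self]
  have h2 := eigenproj_apply_mem (hH.selfAdjoint (a +ᵥ ω)) e
    (translation hν a (ψ - eigenproj (H ω) e ψ))
  -- The projected vector is the translate of an eigenvector η of the original operator, and η is
  -- orthogonal to ψ - P_e ψ.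
  obtain ⟨η, hη⟩ := translation_surjective hν a
    (eigenproj (H (a +ᵥ ω)) e (translation hν a (ψ - eigenproj (H ω) e ψ)))
  rw [← hη] at h2 ⊢
  rw [hH.mem_eigenspace_iff hν] at h2
  rw [LinearIsometry.inner_map_map, ← eigenproj_apply_of_mem h2, ← inner_eigenproj, map_sub,
    ← mul_apply_eq_comp, eigenproj_mul_self, sub_self, inner_zero_left]

theorem IsCovariantOperator.hsNorm_chi_eigenproj_chi (hH : IsCovariantOperator hν H)
    (a x u : Fin d → ℤ) (ω : Ω) (e : ℝ) :
    hsNorm (chi ν (x + a) * eigenproj (H (a +ᵥ ω)) e * chi ν (u + a)) =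
      hsNorm (chi ν x * eigenproj (H ω) e * chi ν u) :=
  hsNorm_eq_of_intertwine (translation_surjective hν a) fun ψ => by
    simp only [mul_apply_eq_comp, chi_translation, hH.eigenproj_translation]

theorem IsCovariantOperator.hsNorm_eigenproj_chi (hH : IsCovariantOperator hν H)
    (a u : Fin d → ℤ) (ω : Ω) (e : ℝ) :
    hsNorm (eigenproj (H (a +ᵥ ω)) e * chi ν (u + a)) = hsNorm (eigenproj (H ω) e * chi ν u) :=
  hsNorm_eq_of_intertwine (translation_surjective hν a) fun ψ => by
    simp only [mul_apply_eq_comp, chi_translation, hH.eigenproj_translation]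

end Covariance

/-! ### Subexponential weights on the lattice -/

section LatticeSums

variable {d : ℕ}

theorem latticePt_sub (x u : Fin d → ℤ) : latticePt (x - u) = latticePt x - latticePt u := by
  ext i; simp [latticePt]

theorem latticePt_mem_span (v : Fin d → ℤ) :
    latticePt v ∈ Submodule.span ℤ (Set.range (Pi.basisFun ℝ (Fin d))) := by
  have h : latticePt v = ∑ i, v i • Pi.basisFun ℝ (Fin d) i := by
    ext j
    simp [latticePt, Finset.sum_apply, Pi.single_apply]
  rw [h]
  exact Submodule.sum_mem _ fun i _ => Submodule.smul_mem _ _ (Submodule.subset_span ⟨i, rfl⟩)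

theorem latticePt_injective : Function.Injective (latticePt (d := d)) := fun v w h =>
  funext fun i => by simpa [latticePt] using congrFun h i

theorem exp_neg_mul_le {c y : ℝ} (hc : 0 < c) (hy : 0 < y) (n : ℕ) :
    Real.exp (-c * y) ≤ (n.factorial / c ^ n) * (y ^ n)⁻¹ := by
  have h1 := Real.pow_div_factorial_le_exp (c * y) (by positivity) n
  have h2 : 0 < (c * y) ^ n / n.factorial := by positivity
  rw [neg_mul, Real.exp_neg]
  refine (inv_anti₀ h2 h1).trans_eq ?_
  rw [mul_pow, inv_div, div_mul_eq_div_div, div_eq_mul_inv _ (y ^ n)]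

theorem summable_exp_neg_norm_rpow {c ζ : ℝ} (hc : 0 < c) (hζ : 0 < ζ) :
    Summable fun v : Fin d → ℤ => Real.exp (-c * ‖latticePt v‖ ^ ζ) := by
  set L := Submodule.span ℤ (Set.range (Pi.basisFun ℝ (Fin d)))
  -- The exponential is dominated by a multiple of |v|^{-nζ}, summable once nζ exceeds the rank; the
  -- origin is handled by a separate indicator.
  obtain ⟨n, hn⟩ := exists_nat_gt ((Module.finrank ℤ L : ℝ) / ζ)
  rw [div_lt_iff₀ hζ] at hn
  have h1 := ZLattice.summable_norm_rpow L (-(n * ζ)) (by linarith)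
  have hinj : Function.Injective fun v : Fin d → ℤ => (⟨latticePt v, latticePt_mem_span v⟩ : L) :=
    fun v w h => latticePt_injective (congrArg Subtype.val h)
  have h2 := h1.comp_injective hinj
  have h3 : Summable fun v : Fin d → ℤ => if v = 0 then (1 : ℝ) else 0 :=
    summable_of_ne_finset_zero (s := {0}) fun v hv => by simpa using hv
  refine Summable.of_nonneg_of_le (fun _ => (Real.exp_pos _).le) (fun v => ?_)
    ((h2.mul_left (n.factorial / c ^ n)).add h3)
  by_cases hv : v = 0
  · subst hv
    have h0 : ‖latticePt (0 : Fin d → ℤ)‖ = 0 := by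
      rw [norm_eq_zero]; ext i; simp [latticePt]
    rw [h0, Real.zero_rpow hζ.ne', mul_zero, Real.exp_zero, if_pos rfl]
    have : 0 ≤ n.factorial / c ^ n *
        ((fun z : L => ‖z‖ ^ (-(n * ζ))) ∘ fun v => ⟨latticePt v, latticePt_mem_span v⟩) 0 := by
      simp only [Function.comp_apply]; positivity
    linarith
  · have hp : 0 < ‖latticePt v‖ := by
      rw [norm_pos_iff]
      intro h
      exact hv (latticePt_injective (h.trans (by ext i; simp [latticePt])))
    rw [if_neg hv, add_zero]
    refine (exp_neg_mul_le hc (Real.rpow_pos_of_pos hp ζ) n).trans_eq ?_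
    simp only [Function.comp_apply, Submodule.coe_norm]
    rw [Real.rpow_neg hp.le, mul_comm (n : ℝ), Real.rpow_mul hp.le, Real.rpow_natCast]

theorem tsum_exp_neg_norm_rpow_lt_top {c ζ : ℝ} (hc : 0 < c) (hζ : 0 < ζ) :
    ∑' v : Fin d → ℤ, ENNReal.ofReal (Real.exp (-c * ‖latticePt v‖ ^ ζ)) < ∞ := by
  rw [← ENNReal.ofReal_tsum_of_nonneg (fun _ => (Real.exp_pos _).le)
      (summable_exp_neg_norm_rpow hc hζ)]
  exact ENNReal.ofReal_lt_top

theorem tsum_exp_neg_norm_rpow_const {c ζ : ℝ} (u : Fin d → ℤ) :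
    ∑' v : Fin d → ℤ, ENNReal.ofReal (Real.exp (-c * ‖latticePt (v - u)‖ ^ ζ)) =
      ∑' v : Fin d → ℤ, ENNReal.ofReal (Real.exp (-c * ‖latticePt v‖ ^ ζ)) :=
  (Equiv.subRight u).tsum_eq fun v : Fin d → ℤ =>
    ENNReal.ofReal (Real.exp (-c * ‖latticePt v‖ ^ ζ))

/-- Subadditivity of s ↦ s^ζ for ζ ≤ 1: |x - u|^ζ obeys the triangle inequality, which makes
subexponential decay stable under convolution. -/
theorem rpow_norm_add_le {F : Type*} [SeminormedAddCommGroup F] {ζ : ℝ} (h0 : 0 < ζ) (h1 : ζ ≤ 1)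
    (a b : F) : ‖a + b‖ ^ ζ ≤ ‖a‖ ^ ζ + ‖b‖ ^ ζ :=
  (Real.rpow_le_rpow (norm_nonneg _) (norm_add_le _ _) h0.le).trans
    (Real.rpow_add_le_add_rpow (norm_nonneg _) (norm_nonneg _) h0.le h1)

theorem rpow_norm_lattice_triangle {ζ : ℝ} (h0 : 0 < ζ) (h1 : ζ ≤ 1) (x v u : Fin d → ℤ) :
    ‖latticePt (x - u)‖ ^ ζ ≤ ‖latticePt (x - v)‖ ^ ζ + ‖latticePt (v - u)‖ ^ ζ := by
  have : latticePt (x - u) = latticePt (x - v) + latticePt (v - u) := by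
    simp only [latticePt_sub]; abel
  rw [this]
  exact rpow_norm_add_le h0 h1 _ _

theorem rpow_norm_le_of_mem_box {ζ : ℝ} (h0 : 0 < ζ) (h1 : ζ ≤ 1) {x : Fin d → ℤ}
    {y : Fin d → ℝ} (hy : y ∈ box x) (u : Fin d → ℤ) :
    ‖y - latticePt u‖ ^ ζ ≤ ‖latticePt (x - u)‖ ^ ζ + 1 ∧
      ‖latticePt (x - u)‖ ^ ζ - 1 ≤ ‖y - latticePt u‖ ^ ζ := by
  have h2 : ‖y - latticePt x‖ ^ ζ ≤ 1 := by
    refine Real.rpow_le_one (norm_nonneg _) ?_ h0.le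
    have : ‖y - latticePt x‖ < 1 / 2 := by rwa [box, mem_ball_iff_norm] at hy
    linarith
  rw [latticePt_sub]
  constructor
  · have : y - latticePt u = (latticePt x - latticePt u) + (y - latticePt x) := by abel
    have h3 := rpow_norm_add_le h0 h1 (latticePt x - latticePt u) (y - latticePt x)
    rw [← this] at h3
    linarith
  · have : latticePt x - latticePt u = (y - latticePt u) + (latticePt x - y) := by abel
    have h3 := rpow_norm_add_le h0 h1 (y - latticePt u) (latticePt x - y)
    rw [← this, norm_sub_rev (latticePt x) y] at h3
    linarith

end LatticeSums

/-! ### Moments compared with sums over boxes -/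

section Moment

variable {d : ℕ} {ν : Measure (Fin d → ℝ)}

/-- On a box the weight differs from its value at the centre by a factor between e^{-σ} and e^σ;
keep a single box of the integral. -/
theorem le_moment {ζ σ : ℝ} (h0 : 0 < ζ) (h1 : ζ ≤ 1) (hσ : 0 < σ) (H : L2 ν →ₗ.[ℂ] L2 ν)
    (x u : Fin d → ℤ) (X : ℝ → ℝ) (t : ℝ) :
    ENNReal.ofReal (Real.exp (σ * (‖latticePt (x - u)‖ ^ ζ - 1))) *
      hsNorm (chi ν x * evolution H X t * chi ν u) ^ 2 ≤ moment H u σ ζ X t := by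
  rw [mul_assoc, hsNorm_sq, ← ENNReal.tsum_mul_left, moment]
  refine ENNReal.tsum_le_tsum fun i => ?_
  rw [mul_apply_eq_comp, enorm_chi_sq, ← lintegral_const_mul' _ _ ENNReal.ofReal_ne_top]
  refine le_trans ?_ (setLIntegral_le_lintegral (box x) _)
  refine setLIntegral_mono' (measurableSet_box x) fun y hy => ?_
  gcongr
  exact (rpow_norm_le_of_mem_box h0 h1 hy u).2

theorem moment_le (hν : ν = volume ∨ ν = latticeMeasure d) {ζ σ : ℝ} (h0 : 0 < ζ) (h1 : ζ ≤ 1)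
    (hσ : 0 < σ) (H : L2 ν →ₗ.[ℂ] L2 ν) (u : Fin d → ℤ) (X : ℝ → ℝ) (t : ℝ) :
    moment H u σ ζ X t ≤ ∑' x : Fin d → ℤ,
      ENNReal.ofReal (Real.exp (σ * (‖latticePt (x - u)‖ ^ ζ + 1))) *
        hsNorm (chi ν x * evolution H X t * chi ν u) ^ 2 := by
  simp_rw [mul_assoc, hsNorm_sq, ← ENNReal.tsum_mul_left]
  rw [ENNReal.tsum_comm, moment]
  refine ENNReal.tsum_le_tsum fun i => ?_
  rw [lintegral_eq_tsum_box hν]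
  refine ENNReal.tsum_le_tsum fun x => ?_
  rw [mul_apply_eq_comp (chi ν x), enorm_chi_sq,
    ← lintegral_const_mul' _ _ ENNReal.ofReal_ne_top]
  refine setLIntegral_mono' (measurableSet_box x) fun y hy => ?_
  gcongr
  exact (rpow_norm_le_of_mem_box h0 h1 hy u).1

end Moment

/-! ### Eigenprojection kernels and correlators -/

section Kernel

variable {d : ℕ} {ν : Measure (Fin d → ℝ)}

/-- The Hilbert-Schmidt norm of the kernel `χ_x P_e χ_u`. -/
def eigenKernel (H : L2 ν →ₗ.[ℂ] L2 ν) (x u : Fin d → ℤ) (e : ℝ) : ℝ≥0∞ :=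
  hsNorm (chi ν x * eigenproj H e * chi ν u)

/-- The quantity `∑ₑ 𝒳(e)² ‖χ_x P_e χ_u‖₂²`, the time mean of `‖χ_x e^{-itH} 𝒳(H) χ_u‖₂²`. -/
def correlator (H : L2 ν →ₗ.[ℂ] L2 ν) (X : ℝ → ℝ) (x u : Fin d → ℤ) : ℝ≥0∞ :=
  ∑' e : ℝ, (ENNReal.ofReal (X e) * eigenKernel H x u e) ^ 2

/-- `tr χ_u χ_{(a,b)}(H) χ_u ≤ C ^ 2`, for the pure point part. -/
def TraceBound (H : L2 ν →ₗ.[ℂ] L2 ν) (a b : ℝ) (C : ℝ≥0∞) : Prop :=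
  ∀ u, ∑' e : Ioo a b, hsNorm (eigenproj H e * chi ν u) ^ 2 ≤ C ^ 2

variable {H : L2 ν →ₗ.[ℂ] L2 ν} {a b : ℝ} {C M : ℝ≥0∞} {X : ℝ → ℝ}

theorem hsNorm_eigenproj_chi_comm (x : Fin d → ℤ) (e : ℝ) :
    hsNorm (chi ν x * eigenproj H e) = hsNorm (eigenproj H e * chi ν x) := by
  rw [← hsNorm_star, star_mul, star_chi, star_eigenproj]

theorem eigenKernel_le (x u : Fin d → ℤ) (e : ℝ) :
    eigenKernel H x u e ≤ hsNorm (eigenproj H e * chi ν x) * hsNorm (eigenproj H e * chi ν u) := by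
  have h : chi ν x * eigenproj H e * chi ν u =
      (chi ν x * eigenproj H e) * (eigenproj H e * chi ν u) := by
    rw [mul_assoc, mul_assoc, ← mul_assoc (eigenproj H e), eigenproj_mul_self]
  rw [eigenKernel, h, ← hsNorm_eigenproj_chi_comm x]
  exact hsNorm_mul_le _ _

/-- Insert P_e = P_e² and the partition 1 = ∑_v χ_v between the two factors. The resulting quadratic
bound lets square roots be traded for summability in e. -/
theorem eigenKernel_le_tsum (hν : ν = volume ∨ ν = latticeMeasure d) (x u : Fin d → ℤ) (e : ℝ) :
    eigenKernel H x u e ≤ ∑' v, eigenKernel H x v e * eigenKernel H v u e := by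
  have h1 : ∀ v, hsNorm ((chi ν x * eigenproj H e * chi ν v) * (chi ν v * eigenproj H e * chi ν u))
      ≤ eigenKernel H x v e * eigenKernel H v u e := fun v => hsNorm_mul_le _ _
  refine le_trans ?_ (ENNReal.tsum_le_tsum h1)
  refine (hsNorm_le_tsum (fun _ => 1) (fun v =>
    (chi ν x * eigenproj H e * chi ν v) * (chi ν v * eigenproj H e * chi ν u)) fun ψ => ?_).trans
    (by simp)
  have h2 := (hasSum_chi hν (eigenproj H e (chi ν u ψ))).mapL (chi ν x * eigenproj H e)
  have h3 : (chi ν x * eigenproj H e) (eigenproj H e (chi ν u ψ)) =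
      (chi ν x * eigenproj H e * chi ν u) ψ := by
    simp only [mul_apply_eq_comp]
    rw [← mul_apply_eq_comp (eigenproj H e), eigenproj_mul_self]
  rw [h3] at h2
  refine (enorm_le_tsum_of_hasSum h2).trans_eq (tsum_congr fun v => ?_)
  simp only [mul_apply_eq_comp, one_mul]
  rw [← mul_apply_eq_comp (chi ν v) (chi ν v), chi_mul_self]

theorem TraceBound.tsum_eigenKernel_le (h : TraceBound H a b C) (x u : Fin d → ℤ) :
    ∑' e : Ioo a b, eigenKernel H x u e ≤ C ^ 2 := by
  rw [← sq_le_sq_ennreal]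
  calc (∑' e : Ioo a b, eigenKernel H x u e) ^ 2
      ≤ (∑' e : Ioo a b, hsNorm (eigenproj H e * chi ν x) * hsNorm (eigenproj H e * chi ν u)) ^ 2 :=
        pow_le_pow_left' (ENNReal.tsum_le_tsum fun e => eigenKernel_le _ _ _) 2
    _ ≤ _ := tsum_mul_sq_le _ _
    _ ≤ C ^ 2 * C ^ 2 := mul_le_mul' (h x) (h u)
    _ = _ := (sq _).symm

theorem tsum_eq_tsum_Ioo (hX : tsupport X ⊆ Ioo a b) {f : ℝ → ℝ≥0∞}
    (hf : ∀ e, X e = 0 → f e = 0) : ∑' e : ℝ, f e = ∑' e : Ioo a b, f e := by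
  refine (tsum_subtype_eq_of_support_subset (f := f) fun e he => hX (subset_tsupport X ?_)).symm
  exact fun h => he (hf e h)

theorem TraceBound.tsum_mul_eigenKernel_le (h : TraceBound H a b C) (hX : tsupport X ⊆ Ioo a b)
    (hM : ∀ e, ENNReal.ofReal (X e) ≤ M) (x u : Fin d → ℤ) :
    ∑' e : ℝ, ENNReal.ofReal (X e) * eigenKernel H x u e ≤ M * C ^ 2 := by
  rw [tsum_eq_tsum_Ioo hX fun e he => by simp [he]]
  refine le_trans ?_ (mul_le_mul_right (h.tsum_eigenKernel_le x u) M)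
  rw [← ENNReal.tsum_mul_left]
  exact ENNReal.tsum_le_tsum fun e => mul_le_mul_left (hM e) _

theorem le_correlator (x u : Fin d → ℤ) (e : ℝ) :
    (ENNReal.ofReal (X e) * eigenKernel H x u e) ^ 2 ≤ correlator H X x u :=
  ENNReal.le_tsum (f := fun e => (ENNReal.ofReal (X e) * eigenKernel H x u e) ^ 2) e

theorem sqrt_mul_sqrt (p : ℝ≥0∞) : p ^ (1 / 2 : ℝ) * p ^ (1 / 2 : ℝ) = p := by
  rw [← ENNReal.rpow_add_of_nonneg _ _ (by norm_num) (by norm_num)]; norm_num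

theorem sqrt_sq (p : ℝ≥0∞) : (p ^ (1 / 2 : ℝ)) ^ 2 = p := by
  rw [sq, sqrt_mul_sqrt]

theorem iSup_le_sqrt_correlator (x u : Fin d → ℤ) :
    ⨆ e : ℝ, ENNReal.ofReal (X e) * eigenKernel H x u e ≤ correlator H X x u ^ (1 / 2 : ℝ) := by
  refine iSup_le fun e => ?_
  rw [← sq_le_sq_ennreal, sqrt_sq]
  exact le_correlator x u e

/-- In each square one factor is bounded by the supremum and the other is summed with the trace
bound. -/
theorem TraceBound.correlator_le (h : TraceBound H a b C) (hX : tsupport X ⊆ Ioo a b)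
    (hM : ∀ e, ENNReal.ofReal (X e) ≤ M) (x u : Fin d → ℤ) :
    correlator H X x u ≤
      (M * C ^ 2) * ⨆ e : ℝ, ENNReal.ofReal (X e) * eigenKernel H x u e := by
  refine le_trans ?_ (mul_le_mul_left (h.tsum_mul_eigenKernel_le hX hM x u) _)
  rw [← ENNReal.tsum_mul_right, correlator]
  refine ENNReal.tsum_le_tsum fun e => ?_
  rw [sq]
  exact mul_le_mul_right (le_iSup (fun e => ENNReal.ofReal (X e) * eigenKernel H x u e) e) _

theorem sqrt_mul_le {p q r s t : ℝ≥0∞} (hp : p ^ 2 ≤ r) (hq : q ^ 2 ≤ s) :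
    p ^ (1 / 2 : ℝ) * q ^ (1 / 2 : ℝ) * t ≤ r ^ (1 / 4 : ℝ) * s ^ (1 / 4 : ℝ) * t := by
  have h : ∀ {p r : ℝ≥0∞}, p ^ 2 ≤ r → p ^ (1 / 2 : ℝ) ≤ r ^ (1 / 4 : ℝ) := fun {p r} h => by
    have h1 := ENNReal.rpow_le_rpow h (z := 1 / 4) (by norm_num)
    rw [← ENNReal.rpow_two, ← ENNReal.rpow_mul] at h1
    norm_num at h1 ⊢
    exact h1
  exact mul_le_mul_left (mul_le_mul' (h hp) (h hq)) _

/-- The sum `∑ₑ 𝒳(e) ‖χ_x P_e χ_u‖₂` is controlled by the correlators. -/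
theorem TraceBound.tsum_mul_eigenKernel_le_tsum (hν : ν = volume ∨ ν = latticeMeasure d)
    (h : TraceBound H a b C) (hX : tsupport X ⊆ Ioo a b) (x u : Fin d → ℤ) :
    ∑' e : ℝ, ENNReal.ofReal (X e) * eigenKernel H x u e ≤ C ^ 2 *
      ∑' v, correlator H X x v ^ (1 / 4 : ℝ) * correlator H X v u ^ (1 / 4 : ℝ) := by
  calc ∑' e : ℝ, ENNReal.ofReal (X e) * eigenKernel H x u e
      = ∑' e : Ioo a b, ENNReal.ofReal (X e) * eigenKernel H x u e :=
        tsum_eq_tsum_Ioo hX fun e he => by simp [he]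
    _ ≤ ∑' e : Ioo a b, ∑' v, ENNReal.ofReal (X e) *
          (eigenKernel H x v e * eigenKernel H v u e) := by
        refine ENNReal.tsum_le_tsum fun e => ?_
        rw [ENNReal.tsum_mul_left]
        exact mul_le_mul_right (eigenKernel_le_tsum hν x u e) _
    _ = ∑' v, ∑' e : Ioo a b, ENNReal.ofReal (X e) *
          (eigenKernel H x v e * eigenKernel H v u e) := ENNReal.tsum_comm
    _ ≤ ∑' v, correlator H X x v ^ (1 / 4 : ℝ) * correlator H X v u ^ (1 / 4 : ℝ) * C ^ 2 := by
        refine ENNReal.tsum_le_tsum fun v => ?_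
        -- Each of the three factors is split into two square roots; (𝒳 k_e)^{1/2} is at most
        -- Q^{1/4}, since (𝒳 k_e)² is one term of Q.
        have h1 : ∀ e : Ioo a b, ENNReal.ofReal (X e) *
            (eigenKernel H x v e * eigenKernel H v u e) ≤
            correlator H X x v ^ (1 / 4 : ℝ) * correlator H X v u ^ (1 / 4 : ℝ) *
            (eigenKernel H x v e ^ (1 / 2 : ℝ) * eigenKernel H v u e ^ (1 / 2 : ℝ)) := by
          intro e
          refine le_trans (le_of_eq ?_)
            (sqrt_mul_le (le_correlator x v e) (le_correlator v u e))
          rw [ENNReal.mul_rpow_of_nonneg _ _ (by norm_num),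
            ENNReal.mul_rpow_of_nonneg _ _ (by norm_num)]
          conv_lhs => rw [← sqrt_mul_sqrt (ENNReal.ofReal (X e)),
            ← sqrt_mul_sqrt (eigenKernel H x v e), ← sqrt_mul_sqrt (eigenKernel H v u e)]
          ring
        refine (ENNReal.tsum_le_tsum h1).trans ?_
        rw [ENNReal.tsum_mul_left]
        refine mul_le_mul_right ?_ _
        -- Cauchy–Schwarz over e: both sums of kernels are at most C².
        rw [← sq_le_sq_ennreal]
        refine (tsum_mul_sq_le _ _).trans ?_
        simp_rw [sqrt_sq]
        rw [sq (C ^ 2)]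
        exact mul_le_mul' (h.tsum_eigenKernel_le x v) (h.tsum_eigenKernel_le v u)
    _ = _ := by rw [ENNReal.tsum_mul_right, mul_comm]

theorem enorm_ofReal_of_nonneg {r : ℝ} (h : 0 ≤ r) : ‖(r : ℂ)‖ₑ = ENNReal.ofReal r := by
  rw [← ofReal_norm, Complex.norm_real, Real.norm_of_nonneg h]

theorem enorm_exp_phase_mul {X : ℝ → ℝ} (h : ∀ l, 0 ≤ X l) (t e : ℝ) :
    ‖Complex.exp (-(Complex.I * t * e)) * (X e : ℂ)‖ₑ = ENNReal.ofReal (X e) := by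
  rw [enorm_mul, enorm_ofReal_of_nonneg (h e), ← ofReal_norm, norm_exp_phase, ENNReal.ofReal_one,
    one_mul]

section PurePoint

variable {I : Set ℝ} (hH : IsSelfAdjoint H) (hpp : HasPurePointSpectrumIn H I)
  (hX : X ∈ testFunctions I)
include hH hpp hX

theorem hasSum_evolution (t : ℝ) (ψ : L2 ν) :
    HasSum (fun e : ℝ => (Complex.exp (-(Complex.I * t * e)) * (X e : ℂ)) • eigenproj H e ψ)
      (evolution H X t ψ) := by
  obtain ⟨h1, h2, h3, -⟩ := hX
  refine hpp.hasSum_funcCalc hH (continuous_evolutionSymbol h1.continuous t)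
    (hasCompactSupport_evolutionSymbol h2 t) ?_ ψ
  rw [tsupport_evolutionSymbol]
  exact h3

theorem hsNorm_evolution_le (x u : Fin d → ℤ) (t : ℝ) :
    hsNorm (chi ν x * evolution H X t * chi ν u) ≤
      ∑' e : ℝ, ENNReal.ofReal (X e) * eigenKernel H x u e := by
  refine hsNorm_le_tsum _ (fun e => chi ν x * eigenproj H e * chi ν u) fun ψ => ?_
  have h1 := (hasSum_evolution hH hpp hX t (chi ν u ψ)).mapL (chi ν x)
  refine (enorm_le_tsum_of_hasSum h1).trans_eq (tsum_congr fun e => ?_)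
  rw [map_smul, enorm_smul, enorm_exp_phase_mul hX.2.2.2]
  rfl

/-- The coefficients 𝒳(e)⟨φ, P_e ψ⟩ = 𝒳(e)⟨P_e φ, P_e ψ⟩ are absolutely summable by Bessel's
inequality, so Wiener's theorem applies. -/
theorem tendsto_timeMean_inner_evolution (φ ψ : L2 ν) :
    Filter.Tendsto (timeMean fun t => ‖⟪φ, evolution H X t ψ⟫_ℂ‖ₑ ^ 2) Filter.atTop
      (nhds (∑' e : ℝ, (ENNReal.ofReal (X e) * ‖⟪φ, eigenproj H e ψ⟫_ℂ‖ₑ) ^ 2)) := by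
  obtain ⟨M, hM⟩ := hX.2.1.exists_bound_of_continuous hX.1.continuous
  have hM0 : 0 ≤ M := (norm_nonneg _).trans (hM 0)
  have hb : ∀ e, ‖(X e : ℂ) * ⟪φ, eigenproj H e ψ⟫_ℂ‖ ≤
      M * (‖eigenproj H e φ‖ ^ 2 + ‖eigenproj H e ψ‖ ^ 2) := fun e => by
    rw [norm_mul, Complex.norm_real]
    refine mul_le_mul (hM e) ?_ (norm_nonneg _) hM0
    have h1 := norm_inner_le_norm (𝕜 := ℂ) (eigenproj H e φ) (eigenproj H e ψ)
    rw [inner_eigenproj, ← mul_apply_eq_comp, eigenproj_mul_self] at h1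
    nlinarith [sq_nonneg (‖eigenproj H e φ‖ - ‖eigenproj H e ψ‖),
      sq_nonneg ‖eigenproj H e φ‖, sq_nonneg ‖eigenproj H e ψ‖]
  have hs : Summable fun e : ℝ => ‖(X e : ℂ) * ⟪φ, eigenproj H e ψ⟫_ℂ‖ :=
    Summable.of_nonneg_of_le (fun _ => norm_nonneg _) hb
      (((summable_norm_eigenproj_sq hH φ).add (summable_norm_eigenproj_sq hH ψ)).mul_left M)
  have h2 := tendsto_timeMean hs (F := fun t => ⟪φ, evolution H X t ψ⟫_ℂ) fun t => by
    have := (hasSum_evolution hH hpp hX t ψ).mapL (innerSL ℂ φ)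
    simpa only [innerSL_apply_apply, inner_smul_right, mul_assoc] using this
  simpa only [enorm_mul, enorm_ofReal_of_nonneg (hX.2.2.2 _)] using h2

end PurePoint

end Kernel

/-! ### Correlators as lower bounds for time means -/

section TimeMean

theorem tsum_liminf_le {ι : Type*} (f : ℕ → ι → ℝ≥0∞) :
    ∑' i, Filter.liminf (fun n => f n i) Filter.atTop ≤
      Filter.liminf (fun n => ∑' i, f n i) Filter.atTop := by
  let _ : MeasurableSpace ι := ⊤
  simpa only [lintegral_count] using
    lintegral_liminf_le (μ := Measure.count) (f := f) fun _ => measurable_from_top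

theorem timeMean_le_of_le {f : ℝ → ℝ≥0∞} {K : ℝ≥0∞} (h : ∀ t, f t ≤ K) (n : ℕ) :
    timeMean f n ≤ K := by
  have h0 : (0 : ℝ) < n + 1 := by positivity
  calc timeMean f n ≤ ENNReal.ofReal (1 / (n + 1)) * ∫⁻ _ in Ioc (0 : ℝ) (n + 1), K :=
        mul_le_mul_right (lintegral_mono h) _
    _ = ENNReal.ofReal (1 / (n + 1)) * ENNReal.ofReal (n + 1) * K := by
        rw [setLIntegral_const, Real.volume_Ioc, sub_zero, mul_comm K, mul_assoc]
    _ = K := by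
        rw [← ENNReal.ofReal_mul (by positivity), one_div_mul_cancel h0.ne', ENNReal.ofReal_one,
          one_mul]

theorem timeMean_tsum {ι : Type*} [Countable ι] {f : ι → ℝ → ℝ≥0∞} (hf : ∀ i, Measurable (f i))
    (n : ℕ) : timeMean (fun t => ∑' i, f i t) n = ∑' i, timeMean (f i) n := by
  simp only [timeMean]
  rw [lintegral_tsum fun i => (hf i).aemeasurable, ENNReal.tsum_mul_left]

variable {d : ℕ} {ν : Measure (Fin d → ℝ)}

/-- The squared matrix element of `χ_x e^{-itH} 𝒳(H) χ_u` between two basis vectors. -/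
def evolutionEntry (H : L2 ν →ₗ.[ℂ] L2 ν) (X : ℝ → ℝ) (x u : Fin d → ℤ)
    (p : basisIndex (L2 ν) × basisIndex (L2 ν)) (t : ℝ) : ℝ≥0∞ :=
  ‖⟪chi ν x (basis (L2 ν) p.2), evolution H X t (chi ν u (basis (L2 ν) p.1))⟫_ℂ‖ₑ ^ 2

/-- The squared matrix element of `𝒳(e) χ_x P_e χ_u` between two basis vectors, summed over `e`. -/
def correlatorEntry (H : L2 ν →ₗ.[ℂ] L2 ν) (X : ℝ → ℝ) (x u : Fin d → ℤ)
    (p : basisIndex (L2 ν) × basisIndex (L2 ν)) : ℝ≥0∞ :=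
  ∑' e : ℝ, (ENNReal.ofReal (X e) *
    ‖⟪chi ν x (basis (L2 ν) p.2), eigenproj H e (chi ν u (basis (L2 ν) p.1))⟫_ℂ‖ₑ) ^ 2

theorem hsNorm_chi_mul_chi_sq (A : L2 ν →L[ℂ] L2 ν) (x u : Fin d → ℤ) :
    hsNorm (chi ν x * A * chi ν u) ^ 2 =
      ∑' p : basisIndex (L2 ν) × basisIndex (L2 ν),
        ‖⟪chi ν x (basis (L2 ν) p.2), A (chi ν u (basis (L2 ν) p.1))⟫_ℂ‖ₑ ^ 2 := by
  rw [hsNorm_sq_eq_tsum_tsum, ENNReal.tsum_prod']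
  simp only [mul_apply_eq_comp, inner_chi]

theorem correlator_eq_tsum (H : L2 ν →ₗ.[ℂ] L2 ν) (X : ℝ → ℝ) (x u : Fin d → ℤ) :
    correlator H X x u = ∑' p, correlatorEntry H X x u p := by
  simp only [correlator, correlatorEntry, eigenKernel, mul_pow]
  rw [ENNReal.tsum_comm]
  refine tsum_congr fun e => ?_
  rw [hsNorm_chi_mul_chi_sq, ENNReal.tsum_mul_left]

theorem hsNorm_evolution_sq (H : L2 ν →ₗ.[ℂ] L2 ν) (X : ℝ → ℝ) (x u : Fin d → ℤ) (t : ℝ) :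
    hsNorm (chi ν x * evolution H X t * chi ν u) ^ 2 = ∑' p, evolutionEntry H X x u p t :=
  hsNorm_chi_mul_chi_sq _ x u

theorem correlatorEntry_eq_liminf {H : L2 ν →ₗ.[ℂ] L2 ν} (hH : IsSelfAdjoint H) {I : Set ℝ}
    (hpp : HasPurePointSpectrumIn H I) {X : ℝ → ℝ} (hX : X ∈ testFunctions I)
    (x u : Fin d → ℤ) (p : basisIndex (L2 ν) × basisIndex (L2 ν)) :
    correlatorEntry H X x u p =
      Filter.liminf (timeMean (evolutionEntry H X x u p)) Filter.atTop :=
  (tendsto_timeMean_inner_evolution hH hpp hX _ _).liminf_eq.symm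

/-- The correlator is at most the time mean of `‖χ_x e^{-itH} 𝒳(H) χ_u‖₂²`. -/
theorem correlator_le_liminf (hν : ν = volume ∨ ν = latticeMeasure d) {H : L2 ν →ₗ.[ℂ] L2 ν}
    (hH : IsSelfAdjoint H) {I : Set ℝ} (hpp : HasPurePointSpectrumIn H I) {X : ℝ → ℝ}
    (hX : X ∈ testFunctions I) (x u : Fin d → ℤ) :
    correlator H X x u ≤ Filter.liminf (timeMean fun t =>
      hsNorm (chi ν x * evolution H X t * chi ν u) ^ 2) Filter.atTop := by
  have := separableSpace_L2 hν
  have := countable_basisIndex (E := L2 ν)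
  have hm : ∀ p, Measurable (evolutionEntry H X x u p) := fun p =>
    (Continuous.measurable (continuous_const.inner ((ContinuousLinearMap.apply ℂ (L2 ν)
      (chi ν u (basis (L2 ν) p.1))).continuous.comp
      (continuous_evolution hH hX.1.continuous hX.2.1)))).enorm.pow_const 2
  have h1 : (timeMean fun t => hsNorm (chi ν x * evolution H X t * chi ν u) ^ 2) =
      fun n => ∑' p, timeMean (evolutionEntry H X x u p) n := by
    ext n
    simp_rw [hsNorm_evolution_sq]
    exact timeMean_tsum hm n
  -- Wiener's limit holds for each matrix element; Fatou over the pairs of basis vectors costs only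
  -- an inequality.
  rw [h1, correlator_eq_tsum]
  simp_rw [correlatorEntry_eq_liminf hH hpp hX]
  exact tsum_liminf_le _

/-- The square of the left side is at most the correlator, hence at most a time mean, hence at most
the squared supremum over t. -/
theorem iSup_eigenKernel_le_iSup_evolution (hν : ν = volume ∨ ν = latticeMeasure d)
    {H : L2 ν →ₗ.[ℂ] L2 ν} (hH : IsSelfAdjoint H) {I : Set ℝ}
    (hpp : HasPurePointSpectrumIn H I) {X : ℝ → ℝ} (hX : X ∈ testFunctions I)
    (x u : Fin d → ℤ) :
    ⨆ e : ℝ, ENNReal.ofReal (X e) * eigenKernel H x u e ≤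
      ⨆ t : ℝ, hsNorm (chi ν x * evolution H X t * chi ν u) := by
  refine (iSup_le_sqrt_correlator x u).trans ?_
  rw [← sq_le_sq_ennreal, sqrt_sq]
  refine (correlator_le_liminf hν hH hpp hX x u).trans ?_
  refine Filter.liminf_le_of_frequently_le' (Filter.Frequently.of_forall fun n => ?_)
  exact timeMean_le_of_le (fun t => pow_le_pow_left' (le_iSup
    (fun t => hsNorm (chi ν x * evolution H X t * chi ν u)) t) 2) n

variable {Ω : Type*} [MeasurableSpace Ω]

theorem Measurable.timeMean {f : ℝ → Ω → ℝ≥0∞} (hf : Measurable (Function.uncurry f)) (n : ℕ) :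
    Measurable fun ω => timeMean (fun t => f t ω) n :=
  (Measurable.lintegral_prod_left' hf).const_mul _

/-- The sum over uncountably many e is not visibly measurable. Almost surely it equals a countable
sum of lower limits of time means, which is. -/
theorem aemeasurable_correlator (hν : ν = volume ∨ ν = latticeMeasure d) {P : Measure Ω}
    {H : Ω → L2 ν →ₗ.[ℂ] L2 ν} (hH : ∀ ω, IsSelfAdjoint (H ω))
    (hm : WeaklyMeasurable fun ω => resolventOp (H ω) (-Complex.I)) {I : Set ℝ}
    (hpp : ∀ᵐ ω ∂P, HasPurePointSpectrumIn (H ω) I) {X : ℝ → ℝ} (hX : X ∈ testFunctions I)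
    (x u : Fin d → ℤ) : AEMeasurable (fun ω => correlator (H ω) X x u) P := by
  have := separableSpace_L2 hν
  have := countable_basisIndex (E := L2 ν)
  refine ⟨fun ω => ∑' p, Filter.liminf (timeMean (evolutionEntry (H ω) X x u p)) Filter.atTop,
    ?_, ?_⟩
  · refine Measurable.tsum fun p => Measurable.liminf fun n => ?_
    exact Measurable.timeMean (f := fun t ω => evolutionEntry (H ω) X x u p t)
      ((measurable_inner_evolution hH hm hX.1.continuous hX.2.1 _ _).enorm.pow_const 2) n
  · filter_upwards [hpp] with ω h
    rw [correlator_eq_tsum]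
    exact tsum_congr fun p => correlatorEntry_eq_liminf (hH ω) h hX x u p

end TimeMean

/-! ### Subexponential decay, trace bounds and stationarity -/

section Decay

variable {d : ℕ} {ν : Measure (Fin d → ℝ)} {Ω : Type*} [MeasurableSpace Ω] {P : Measure Ω}
  {H : Ω → L2 ν →ₗ.[ℂ] L2 ν} {I : Set ℝ}

theorem exists_real_bound_iff {α : Type*} (f : α → ℝ≥0∞) (g : α → ℝ) :
    (∃ C : ℝ, ∀ a, f a ≤ ENNReal.ofReal (C * Real.exp (g a))) ↔
      ∃ K : ℝ≥0∞, K ≠ ∞ ∧ ∀ a, f a ≤ K * ENNReal.ofReal (Real.exp (g a)) := by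
  constructor
  · rintro ⟨C, hC⟩
    refine ⟨ENNReal.ofReal C, ENNReal.ofReal_ne_top, fun a => (hC a).trans_eq ?_⟩
    rw [mul_comm, ENNReal.ofReal_mul (Real.exp_pos _).le, mul_comm]
  · rintro ⟨K, hK, h⟩
    refine ⟨K.toReal, fun a => (h a).trans_eq ?_⟩
    rw [ENNReal.ofReal_mul ENNReal.toReal_nonneg, ENNReal.ofReal_toReal hK]

/-- Subexponential decay of a kernel on `ℤ^d`. -/
def SubexpDecay (f : (Fin d → ℤ) → (Fin d → ℤ) → ℝ≥0∞) (ζ σ : ℝ) : Prop :=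
  ∃ K : ℝ≥0∞, K ≠ ∞ ∧ ∀ x u,
    f x u ≤ K * ENNReal.ofReal (Real.exp (-σ * ‖latticePt (x - u)‖ ^ ζ))

theorem subexpDecay_iff (f : (Fin d → ℤ) → (Fin d → ℤ) → ℝ≥0∞) (ζ σ : ℝ) :
    SubexpDecay f ζ σ ↔ ∃ C : ℝ, ∀ x u : Fin d → ℤ,
      f x u ≤ ENNReal.ofReal (C * Real.exp (-σ * ‖latticePt (x - u)‖ ^ ζ)) := by
  have := exists_real_bound_iff (fun p : (Fin d → ℤ) × (Fin d → ℤ) => f p.1 p.2)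
    fun p => -σ * ‖latticePt (p.1 - p.2)‖ ^ ζ
  simp only [Prod.forall] at this
  exact this.symm

theorem SubexpDecay.mono {f g : (Fin d → ℤ) → (Fin d → ℤ) → ℝ≥0∞} {ζ σ : ℝ} {c : ℝ≥0∞}
    (hc : c ≠ ∞) (h : SubexpDecay f ζ σ) (hg : ∀ x u, g x u ≤ c * f x u) : SubexpDecay g ζ σ := by
  obtain ⟨K, hK, h⟩ := h
  refine ⟨c * K, ENNReal.mul_ne_top hc hK, fun x u => (hg x u).trans ?_⟩
  rw [mul_assoc]
  exact mul_le_mul_right (h x u) c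

theorem ofReal_exp_rpow (a p : ℝ) :
    ENNReal.ofReal (Real.exp a) ^ p = ENNReal.ofReal (Real.exp (a * p)) := by
  rw [ENNReal.ofReal_rpow_of_pos (Real.exp_pos _), ← Real.exp_mul]

theorem ofReal_exp_mul_ofReal_exp (a b : ℝ) :
    ENNReal.ofReal (Real.exp a) * ENNReal.ofReal (Real.exp b) =
      ENNReal.ofReal (Real.exp (a + b)) := by
  rw [← ENNReal.ofReal_mul (Real.exp_pos _).le, Real.exp_add]

/-- Hölder with weights 1/4, 1/4 and 1/2, the last on the constant 1 of a probability space. -/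
theorem lintegral_rpow_quarter_mul_le [IsProbabilityMeasure P] {f g : Ω → ℝ≥0∞}
    (hf : AEMeasurable f P) (hg : AEMeasurable g P) :
    ∫⁻ ω, f ω ^ (1 / 4 : ℝ) * g ω ^ (1 / 4 : ℝ) ∂P ≤
      (∫⁻ ω, f ω ∂P) ^ (1 / 4 : ℝ) * (∫⁻ ω, g ω ∂P) ^ (1 / 4 : ℝ) := by
  have h := ENNReal.lintegral_prod_norm_pow_le (μ := P) (Finset.univ : Finset (Fin 3))
    (f := ![f, g, fun _ => 1]) (p := ![1 / 4, 1 / 4, 1 / 2])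
    (by
      intro i _
      fin_cases i
      exacts [hf, hg, aemeasurable_const])
    (by simp only [Fin.sum_univ_three, Matrix.cons_val]; norm_num)
    (by intro i _; fin_cases i <;> norm_num)
  simpa [Fin.prod_univ_three] using h

/-- Convolution of fourth roots preserves subexponential decay. -/
theorem SubexpDecay.tsum_quarter {f : (Fin d → ℤ) → (Fin d → ℤ) → ℝ≥0∞} {ζ σ : ℝ}
    (h0 : 0 < ζ) (h1 : ζ ≤ 1) (hσ : 0 < σ) (h : SubexpDecay f ζ σ) :
    SubexpDecay (fun x u => ∑' v, f x v ^ (1 / 4 : ℝ) * f v u ^ (1 / 4 : ℝ)) ζ (σ / 8) := by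
  obtain ⟨K, hK, h⟩ := h
  set S := ∑' v : Fin d → ℤ, ENNReal.ofReal (Real.exp (-(σ / 8) * ‖latticePt v‖ ^ ζ))
  have hS : S < ∞ := tsum_exp_neg_norm_rpow_lt_top (by positivity) h0
  have hK' : K ^ (1 / 4 : ℝ) ≠ ∞ := ENNReal.rpow_ne_top_of_nonneg (by norm_num) hK
  refine ⟨K ^ (1 / 4 : ℝ) * K ^ (1 / 4 : ℝ) * S,
    ENNReal.mul_ne_top (ENNReal.mul_ne_top hK' hK') hS.ne, fun x u => ?_⟩
  have h2 : ∀ x u, f x u ^ (1 / 4 : ℝ) ≤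
      K ^ (1 / 4 : ℝ) * ENNReal.ofReal (Real.exp (-(σ / 4) * ‖latticePt (x - u)‖ ^ ζ)) := by
    intro x u
    refine (ENNReal.rpow_le_rpow (h x u) (by norm_num)).trans_eq ?_
    rw [ENNReal.mul_rpow_of_nonneg _ _ (by norm_num), ofReal_exp_rpow]
    ring_nf
  -- Fourth roots decay at rate σ/4. Half of it pays for |x - u| through the triangle inequality;
  -- the σ/8 left on |v - u| makes the sum over v converge.
  have h3 : ∀ v, f x v ^ (1 / 4 : ℝ) * f v u ^ (1 / 4 : ℝ) ≤
      K ^ (1 / 4 : ℝ) * K ^ (1 / 4 : ℝ) *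
        ENNReal.ofReal (Real.exp (-(σ / 8) * ‖latticePt (x - u)‖ ^ ζ)) *
        ENNReal.ofReal (Real.exp (-(σ / 8) * ‖latticePt (v - u)‖ ^ ζ)) := by
    intro v
    refine (mul_le_mul' (h2 x v) (h2 v u)).trans ?_
    rw [mul_mul_mul_comm, mul_assoc (K ^ (1 / 4 : ℝ) * _), ofReal_exp_mul_ofReal_exp,
      ofReal_exp_mul_ofReal_exp]
    refine mul_le_mul_right (ENNReal.ofReal_le_ofReal (Real.exp_le_exp.2 ?_)) _
    have ht := rpow_norm_lattice_triangle h0 h1 x v u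
    have hp : 0 ≤ ‖latticePt (x - v)‖ ^ ζ := by positivity
    nlinarith
  refine (ENNReal.tsum_le_tsum h3).trans_eq ?_
  rw [ENNReal.tsum_mul_left, tsum_exp_neg_norm_rpow_const]
  ring

variable (P H I) in
/-- Subexponential decay of the expected correlators. -/
def CorrelatorDecay : Prop :=
  ∃ ζ ∈ Ioc (0 : ℝ) 1, ∃ σ > (0 : ℝ), ∀ X ∈ testFunctions I,
    SubexpDecay (fun x u => ∫⁻ ω, correlator (H ω) X x u ∂P) ζ σ

theorem exists_Ioo_of_testFunction (hIopen : IsOpen I) (hIint : I.OrdConnected) {X : ℝ → ℝ}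
    (hX : X ∈ testFunctions I) : ∃ a b, Icc a b ⊆ I ∧ tsupport X ⊆ Ioo a b := by
  obtain ⟨-, h2, h3, -⟩ := hX
  rcases (tsupport X).eq_empty_or_nonempty with he | hne
  · exact ⟨1, 0, by simp, by simp [he]⟩
  have hc : IsCompact (tsupport X) := h2
  obtain ⟨m, hm, hm'⟩ := hc.exists_isLeast hne
  obtain ⟨M, hM, hM'⟩ := hc.exists_isGreatest hne
  obtain ⟨ε, hε, hεI⟩ := Metric.isOpen_iff.1 hIopen m (h3 hm)
  obtain ⟨δ, hδ, hδI⟩ := Metric.isOpen_iff.1 hIopen M (h3 hM)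
  refine ⟨m - ε / 2, M + δ / 2, hIint.out (hεI ?_) (hδI ?_), fun x hx => ⟨?_, ?_⟩⟩
  · rw [Metric.mem_ball, Real.dist_eq, sub_sub_cancel_left, abs_neg, abs_of_pos (by positivity)]
    linarith
  · rw [Metric.mem_ball, Real.dist_eq, add_sub_cancel_left, abs_of_pos (by positivity)]
    linarith
  · linarith [hm' hx]
  · linarith [hM' hx]

theorem exists_bound_of_testFunction {X : ℝ → ℝ} (hX : X ∈ testFunctions I) :
    ∃ M : ℝ≥0∞, M ≠ ∞ ∧ ∀ e, ENNReal.ofReal (X e) ≤ M := by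
  obtain ⟨M, hM⟩ := hX.2.1.exists_bound_of_continuous hX.1.continuous
  exact ⟨ENNReal.ofReal M, ENNReal.ofReal_ne_top, fun e =>
    ENNReal.ofReal_le_ofReal ((le_abs_self _).trans (hM e))⟩

theorem tsum_Ioo_hsNorm_le {H : L2 ν →ₗ.[ℂ] L2 ν} (hH : IsSelfAdjoint H) (a b : ℝ)
    (u : Fin d → ℤ) : ∑' e : Ioo a b, hsNorm (eigenproj H e * chi ν u) ^ 2 ≤
      hsNorm (spectralProj H (Ioo a b) * chi ν u) ^ 2 := by
  simp_rw [hsNorm_sq]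
  rw [ENNReal.tsum_comm]
  exact ENNReal.tsum_le_tsum fun i => tsum_Ioo_enorm_eigenproj_sq_le hH a b _

theorem norm_spectralProj_apply_le (H : L2 ν →ₗ.[ℂ] L2 ν) (J : Set ℝ) (ψ : L2 ν) :
    ‖spectralProj H J ψ‖ ≤ ‖ψ‖ :=
  Submodule.norm_starProjection_apply_le _ ψ

section Covariant

variable [AddAction (Fin d → ℤ) Ω] [MeasurableConstVAdd (Fin d → ℤ) Ω]
  [VAddInvariantMeasure (Fin d → ℤ) Ω P] (hν : ν = volume ∨ ν = latticeMeasure d)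
  (hH : IsCovariantOperator hν H)
include hH

/-- The hypothesis concerns the box at 0. Invariance of P and covariance carry it to every box,
almost surely for all of the countably many u at once. -/
theorem IsCovariantOperator.ae_traceBound {a b : ℝ}
    (htr : ν = volume → ∃ C : ℝ≥0, ∀ᵐ ω ∂P, hsNorm (spectralProj (H ω) (Ioo a b) * chi ν 0) ^ 2 ≤ C) :
    ∃ C : ℝ≥0∞, C ≠ ∞ ∧ ∀ᵐ ω ∂P, TraceBound (H ω) a b C := by
  have h1 : ∃ C : ℝ≥0∞, C ≠ ∞ ∧
      ∀ᵐ ω ∂P, hsNorm (spectralProj (H ω) (Ioo a b) * chi ν 0) ^ 2 ≤ C ^ 2 := by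
    rcases hν with hv | hl
    · obtain ⟨C, hC⟩ := htr hv
      refine ⟨(C : ℝ≥0∞) ^ (1 / 2 : ℝ), ENNReal.rpow_ne_top_of_nonneg (by norm_num)
        ENNReal.coe_ne_top, ?_⟩
      rwa [sqrt_sq]
    · subst hl
      refine ⟨1, ENNReal.one_ne_top, Filter.Eventually.of_forall fun ω => ?_⟩
      exact pow_le_pow_left' (hsNorm_mul_chi_le_one (norm_spectralProj_apply_le _ _) 0) 2
  obtain ⟨C, hC, h⟩ := h1
  refine ⟨C, hC, ?_⟩
  have h2 : ∀ u : Fin d → ℤ, ∀ᵐ ω ∂P,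
      hsNorm (spectralProj (H (-u +ᵥ ω)) (Ioo a b) * chi ν 0) ^ 2 ≤ C ^ 2 := fun u =>
    (measurePreserving_vadd (-u) P).quasiMeasurePreserving.ae h
  filter_upwards [ae_all_iff.2 h2] with ω hω u
  have h3 := (tsum_Ioo_hsNorm_le (hH.selfAdjoint (-u +ᵥ ω)) a b 0).trans (hω u)
  refine le_trans (le_of_eq (tsum_congr fun e => ?_)) h3
  have h4 := hH.hsNorm_eigenproj_chi hν u 0 (-u +ᵥ ω) e
  rw [vadd_vadd, add_neg_cancel, zero_vadd, zero_add] at h4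
  rw [h4]

/-- Stationarity: an estimate at u = 0 becomes uniform in u. -/
theorem IsCovariantOperator.lintegral_correlator_sub (X : ℝ → ℝ) (x u : Fin d → ℤ) :
    ∫⁻ ω, correlator (H ω) X x u ∂P = ∫⁻ ω, correlator (H ω) X (x - u) 0 ∂P := by
  have h1 := (measurePreserving_vadd u P).lintegral_comp_emb (measurableEmbedding_const_vadd u)
    fun ω => correlator (H ω) X x u
  rw [← h1]
  refine lintegral_congr fun ω => tsum_congr fun e => ?_
  have h2 := hH.hsNorm_chi_eigenproj_chi hν u (x - u) 0 ω e
  rw [sub_add_cancel, zero_add] at h2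
  rw [eigenKernel, eigenKernel, h2]

end Covariant

end Decay

/-! ### From correlators to dynamics and back -/

section Characterizations

variable {d : ℕ} {ν : Measure (Fin d → ℝ)} {Ω : Type*} [MeasurableSpace Ω] {P : Measure Ω}
  {H : Ω → L2 ν →ₗ.[ℂ] L2 ν} {I : Set ℝ}

theorem iSup_evolution_le (hν : ν = volume ∨ ν = latticeMeasure d) {H : L2 ν →ₗ.[ℂ] L2 ν}
    (hH : IsSelfAdjoint H) (hpp : HasPurePointSpectrumIn H I) {X : ℝ → ℝ}
    (hX : X ∈ testFunctions I) {a b : ℝ} {C : ℝ≥0∞} (htb : TraceBound H a b C)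
    (hs : tsupport X ⊆ Ioo a b) (x u : Fin d → ℤ) :
    ⨆ t : ℝ, hsNorm (chi ν x * evolution H X t * chi ν u) ≤ C ^ 2 *
      ∑' v, correlator H X x v ^ (1 / 4 : ℝ) * correlator H X v u ^ (1 / 4 : ℝ) :=
  iSup_le fun t => (hsNorm_evolution_le hH hpp hX x u t).trans
    (htb.tsum_mul_eigenKernel_le_tsum hν hs x u)

/-- In the squared norm one factor is bounded by the constant MC² and only the other by the decaying
sum, so a first-power expectation suffices. -/
theorem iSup_moment_le (hν : ν = volume ∨ ν = latticeMeasure d) {H : L2 ν →ₗ.[ℂ] L2 ν}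
    (hH : IsSelfAdjoint H) (hpp : HasPurePointSpectrumIn H I) {X : ℝ → ℝ}
    (hX : X ∈ testFunctions I) {a b : ℝ} {C M : ℝ≥0∞} (htb : TraceBound H a b C)
    (hs : tsupport X ⊆ Ioo a b) (hM : ∀ e, ENNReal.ofReal (X e) ≤ M) {ζ σ : ℝ} (h0 : 0 < ζ)
    (h1 : ζ ≤ 1) (hσ : 0 < σ) (u : Fin d → ℤ) :
    ⨆ t : ℝ, moment H u σ ζ X t ≤ M * C ^ 2 * C ^ 2 * ∑' x : Fin d → ℤ,
      ENNReal.ofReal (Real.exp (σ * (‖latticePt (x - u)‖ ^ ζ + 1))) *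
        ∑' v, correlator H X x v ^ (1 / 4 : ℝ) * correlator H X v u ^ (1 / 4 : ℝ) := by
  refine iSup_le fun t => (moment_le hν h0 h1 hσ H u X t).trans ?_
  rw [← ENNReal.tsum_mul_left]
  refine ENNReal.tsum_le_tsum fun x => ?_
  have h2 := hsNorm_evolution_le hH hpp hX x u t
  rw [mul_left_comm, sq (hsNorm _), mul_assoc (M * C ^ 2)]
  exact mul_le_mul_right (mul_le_mul' (h2.trans (htb.tsum_mul_eigenKernel_le hs hM x u))
    (h2.trans (htb.tsum_mul_eigenKernel_le_tsum hν hs x u))) _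

theorem lintegral_exp_neg_div {T : ℝ} (hT : 0 < T) :
    ENNReal.ofReal (1 / T) * ∫⁻ t in Ioi (0 : ℝ), ENNReal.ofReal (Real.exp (-t / T)) = 1 := by
  have h1 : ∀ t : ℝ, Real.exp (-t / T) = Real.exp (-(1 / T) * t) := fun t => by
    congr 1; ring
  have hneg : -(1 / T) < 0 := neg_lt_zero.2 (by positivity)
  simp_rw [h1]
  rw [← ofReal_integral_eq_lintegral_ofReal (integrableOn_exp_mul_Ioi hneg 0)
    (Filter.Eventually.of_forall fun _ => (Real.exp_pos _).le), integral_exp_mul_Ioi hneg,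
    ← ENNReal.ofReal_mul (by positivity)]
  have h2 : 1 / T * (-Real.exp (-(1 / T) * 0) / -(1 / T)) = 1 := by
    rw [mul_zero, Real.exp_zero]; field_simp
  rw [h2, ENNReal.ofReal_one]

theorem iSup_laplaceMean_le {f : ℝ → ℝ≥0∞} {K : ℝ≥0∞} (hK : K ≠ ∞) (h : ∀ t, f t ≤ K) :
    (⨆ T ∈ Ioi (0 : ℝ), ENNReal.ofReal (1 / T) *
      ∫⁻ t in Ioi 0, ENNReal.ofReal (Real.exp (-t / T)) * f t) ≤ K := by
  refine iSup₂_le fun T hT => ?_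
  calc _ ≤ ENNReal.ofReal (1 / T) *
        ∫⁻ t in Ioi (0 : ℝ), ENNReal.ofReal (Real.exp (-t / T)) * K :=
        mul_le_mul_right (lintegral_mono fun t => mul_le_mul_right (h t) _) _
    _ = K := by
        rw [lintegral_mul_const' _ _ hK, ← mul_assoc, lintegral_exp_neg_div hT, one_mul]

/-- On (0, T] one has e · e^{-t/T} ≥ 1. -/
theorem iSup_mean_le_laplaceMean (f : ℝ → ℝ≥0∞) :
    (⨆ T ∈ Ioi (0 : ℝ), ENNReal.ofReal (1 / T) * ∫⁻ t in Ioc 0 T, f t) ≤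
      ENNReal.ofReal (Real.exp 1) * ⨆ T ∈ Ioi (0 : ℝ), ENNReal.ofReal (1 / T) *
        ∫⁻ t in Ioi 0, ENNReal.ofReal (Real.exp (-t / T)) * f t := by
  refine iSup₂_le fun T hT => ?_
  refine le_trans ?_ (mul_le_mul_right (le_iSup₂ (f := fun (T : ℝ) (_ : T ∈ Ioi (0 : ℝ)) =>
    ENNReal.ofReal (1 / T) * ∫⁻ t in Ioi 0, ENNReal.ofReal (Real.exp (-t / T)) * f t) T hT) _)
  rw [mul_left_comm]
  refine mul_le_mul_right ?_ _
  rw [← lintegral_const_mul' _ _ ENNReal.ofReal_ne_top]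
  refine le_trans ?_ (lintegral_mono_set (Ioc_subset_Ioi_self (a := T) (b := (0 : ℝ))))
  refine setLIntegral_mono' measurableSet_Ioc fun t ht => ?_
  rw [← mul_assoc, ofReal_exp_mul_ofReal_exp]
  refine le_mul_of_one_le_left' ?_
  rw [ENNReal.one_le_ofReal, Real.one_le_exp_iff]
  have hT' : (0 : ℝ) < T := hT
  have : t / T ≤ 1 := (div_le_one hT').2 ht.2
  rw [neg_div]
  linarith

/-- Fatou and Tonelli are applied to the jointly measurable box norms; the moment enters afterwards
by monotonicity, so its measurability is not needed. -/
theorem lintegral_correlator_le (hν : ν = volume ∨ ν = latticeMeasure d) [SFinite P]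
    (hH : ∀ ω, IsSelfAdjoint (H ω))
    (hm : WeaklyMeasurable fun ω => resolventOp (H ω) (-Complex.I))
    (hpp : ∀ᵐ ω ∂P, HasPurePointSpectrumIn (H ω) I) {X : ℝ → ℝ} (hX : X ∈ testFunctions I)
    {ζ σ : ℝ} (h0 : 0 < ζ) (h1 : ζ ≤ 1) (hσ : 0 < σ) (x u : Fin d → ℤ) :
    ∫⁻ ω, correlator (H ω) X x u ∂P ≤
      ENNReal.ofReal (Real.exp (-(σ * (‖latticePt (x - u)‖ ^ ζ - 1)))) *
        ⨆ T ∈ Ioi (0 : ℝ), ENNReal.ofReal (1 / T) *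
          ∫⁻ t in Ioc 0 T, ∫⁻ ω, moment (H ω) u σ ζ X t ∂P := by
  have := separableSpace_L2 hν
  have hjm := measurable_hsNorm_evolution hH hm hX.1.continuous hX.2.1 (chi ν x) (chi ν u)
  set D : ℝ → Ω → ℝ≥0∞ := fun t ω => hsNorm (chi ν x * evolution (H ω) X t * chi ν u) ^ 2 with hD
  set c := ENNReal.ofReal (Real.exp (-(σ * (‖latticePt (x - u)‖ ^ ζ - 1)))) with hc
  have hDm : ∀ t ω, D t ω ≤ c * moment (H ω) u σ ζ X t := fun t ω => by
    refine le_trans (le_of_eq ?_) (mul_le_mul_right (le_moment h0 h1 hσ (H ω) x u X t) c)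
    rw [← mul_assoc, hc, ofReal_exp_mul_ofReal_exp, neg_add_cancel, Real.exp_zero,
      ENNReal.ofReal_one, one_mul]
  calc ∫⁻ ω, correlator (H ω) X x u ∂P
      ≤ ∫⁻ ω, Filter.liminf (fun n => timeMean (fun t => D t ω) n) Filter.atTop ∂P := by
        refine lintegral_mono_ae ?_
        filter_upwards [hpp] with ω h
        exact correlator_le_liminf hν (hH ω) h hX x u
    _ ≤ Filter.liminf (fun n => ∫⁻ ω, timeMean (fun t => D t ω) n ∂P) Filter.atTop :=
        lintegral_liminf_le fun n => Measurable.timeMean hjm n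
    _ ≤ _ := by
        refine Filter.liminf_le_of_frequently_le' (Filter.Frequently.of_forall fun n => ?_)
        simp only [timeMean]
        have hT : (n + 1 : ℝ) ∈ Ioi (0 : ℝ) := mem_Ioi.2 (by positivity)
        rw [lintegral_const_mul' _ _ ENNReal.ofReal_ne_top, lintegral_lintegral_swap
          (f := fun ω t => D t ω) ((hjm.comp measurable_swap).aemeasurable)]
        refine le_trans ?_ (mul_le_mul_right (le_iSup₂ (f := fun (T : ℝ) (_ : T ∈ Ioi (0 : ℝ)) =>
          ENNReal.ofReal (1 / T) * ∫⁻ t in Ioc 0 T, ∫⁻ ω, moment (H ω) u σ ζ X t ∂P) _ hT) _)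
        rw [mul_left_comm, ← lintegral_const_mul' c _ ENNReal.ofReal_ne_top]
        refine mul_le_mul_right (lintegral_mono fun t => ?_) _
        rw [← lintegral_const_mul' c _ ENNReal.ofReal_ne_top]
        exact lintegral_mono fun ω => hDm t ω

theorem aemeasurable_tsum_correlator {X : ℝ → ℝ}
    (hm : ∀ x u, AEMeasurable (fun ω => correlator (H ω) X x u) P) (x u : Fin d → ℤ) :
    AEMeasurable (fun ω => ∑' v, correlator (H ω) X x v ^ (1 / 4 : ℝ) *
      correlator (H ω) X v u ^ (1 / 4 : ℝ)) P :=
  AEMeasurable.tsum fun v => ((hm x v).pow_const _).mul ((hm v u).pow_const _)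

theorem SubexpDecay.lintegral_tsum_correlator [IsProbabilityMeasure P] {X : ℝ → ℝ}
    (hm : ∀ x u, AEMeasurable (fun ω => correlator (H ω) X x u) P) {ζ σ : ℝ} (h0 : 0 < ζ)
    (h1 : ζ ≤ 1) (hσ : 0 < σ)
    (h : SubexpDecay (fun x u => ∫⁻ ω, correlator (H ω) X x u ∂P) ζ σ) :
    SubexpDecay (fun x u => ∫⁻ ω, ∑' v, correlator (H ω) X x v ^ (1 / 4 : ℝ) *
      correlator (H ω) X v u ^ (1 / 4 : ℝ) ∂P) ζ (σ / 8) := by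
  refine (h.tsum_quarter h0 h1 hσ).mono ENNReal.one_ne_top fun x u => ?_
  rw [one_mul]
  refine (lintegral_tsum fun v =>
    ((hm x v).pow_const (1 / 4)).fun_mul ((hm v u).pow_const (1 / 4))).trans_le ?_
  exact ENNReal.tsum_le_tsum fun v => lintegral_rpow_quarter_mul_le (hm x v) (hm v u)

end Characterizations

end RandomOp

end

/-! ### The equivalence of the five properties -/

open RandomOp in
theorem mainTheorem11 {d : ℕ}
    {ν : Measure (Fin d → ℝ)} (hν : ν = volume ∨ ν = latticeMeasure d)
    {Ω : Type*} [MeasurableSpace Ω] (P : Measure Ω) [IsProbabilityMeasure P]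
    [AddAction (Fin d → ℤ) Ω] [MeasurableConstVAdd (Fin d → ℤ) Ω]
    [ErgodicVAdd (Fin d → ℤ) Ω P]
    (H : Ω → L2 ν →ₗ.[ℂ] L2 ν) (hH : IsCovariantOperator hν H)
    (I : Set ℝ) (hIopen : IsOpen I) (hIint : I.OrdConnected)
    (hIσ : ∀ᵐ ω ∂P, I ⊆ realSpectrum (H ω))
    (hpp : ∀ᵐ ω ∂P, HasPurePointSpectrumIn (H ω) I)
    (htr : ν = volume → ∀ a b : ℝ, Icc a b ⊆ I → ∃ C : ℝ≥0, ∀ᵐ ω ∂P,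
      hsNorm (spectralProj (H ω) (Ioo a b) * chi ν 0) ^ 2 ≤ C) :
    List.TFAE [
      ∃ σ > (0 : ℝ), ∃ ζ ∈ Ioc (0 : ℝ) 1, ∀ u : Fin d → ℤ, ∀ X ∈ testFunctions I,
        (⨆ T ∈ Ioi (0 : ℝ), ENNReal.ofReal (1 / T) *
          ∫⁻ t in Ioc 0 T, ∫⁻ ω, moment (H ω) u σ ζ X t ∂P) < ∞,
      ∃ σ > (0 : ℝ), ∃ ζ ∈ Ioc (0 : ℝ) 1, ∀ u : Fin d → ℤ, ∀ X ∈ testFunctions I,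
        (⨆ T ∈ Ioi (0 : ℝ), ENNReal.ofReal (1 / T) *
          ∫⁻ t in Ioi 0, ENNReal.ofReal (Real.exp (-t / T)) *
            ∫⁻ ω, moment (H ω) u σ ζ X t ∂P) < ∞,
      ∃ σ > (0 : ℝ), ∃ ζ ∈ Ioc (0 : ℝ) 1, ∀ u : Fin d → ℤ, ∀ X ∈ testFunctions I,
        ∫⁻ ω, ⨆ t : ℝ, moment (H ω) u σ ζ X t ∂P < ∞,
      ∃ ζ ∈ Ioc (0 : ℝ) 1, ∃ σ > (0 : ℝ), ∀ X ∈ testFunctions I, ∃ C : ℝ, ∀ x u : Fin d → ℤ,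
        ∫⁻ ω, ⨆ t : ℝ, hsNorm (chi ν x * evolution (H ω) X t * chi ν u) ∂P ≤
          ENNReal.ofReal (C * Real.exp (-σ * ‖latticePt (x - u)‖ ^ ζ)),
      ∃ ζ ∈ Ioc (0 : ℝ) 1, ∃ σ > (0 : ℝ), ∀ X ∈ testFunctions I, ∃ C : ℝ, ∀ x u : Fin d → ℤ,
        ∫⁻ ω, ⨆ e : ℝ, ENNReal.ofReal (X e) *
            hsNorm (chi ν x * eigenproj (H ω) e * chi ν u) ∂P ≤
          ENNReal.ofReal (C * Real.exp (-σ * ‖latticePt (x - u)‖ ^ ζ))] := by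
  have hSA := hH.selfAdjoint
  have hres : WeaklyMeasurable fun ω => resolventOp (H ω) (-Complex.I) :=
    hH.measurable _ (by simp)
  have hmeas : ∀ X ∈ testFunctions I, ∀ x u,
      AEMeasurable (fun ω => correlator (H ω) X x u) P := fun X hX x u =>
    aemeasurable_correlator hν hSA hres hpp hX x u
  have htb : ∀ X ∈ testFunctions I, ∃ a b : ℝ, tsupport X ⊆ Ioo a b ∧
      ∃ C : ℝ≥0∞, C ≠ ∞ ∧ ∀ᵐ ω ∂P, TraceBound (H ω) a b C := fun X hX => by
    obtain ⟨a, b, hI, hs⟩ := exists_Ioo_of_testFunction hIopen hIint hX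
    exact ⟨a, b, hs, hH.ae_traceBound hν fun h => htr h a b hI⟩
  simp only [← subexpDecay_iff]
  tfae_have 3 → 2 := by
    rintro ⟨σ, hσ, ζ, hζ, h⟩
    refine ⟨σ, hσ, ζ, hζ, fun u X hX => lt_of_le_of_lt ?_ (h u X hX)⟩
    exact iSup_laplaceMean_le (h u X hX).ne fun t => lintegral_mono fun ω =>
      le_iSup (fun t => moment (H ω) u σ ζ X t) t
  tfae_have 2 → 1 := by
    rintro ⟨σ, hσ, ζ, hζ, h⟩
    refine ⟨σ, hσ, ζ, hζ, fun u X hX => lt_of_le_of_lt (iSup_mean_le_laplaceMean _) ?_⟩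
    exact ENNReal.mul_lt_top ENNReal.ofReal_lt_top (h u X hX)
  have decay_of_one : (∃ σ > (0 : ℝ), ∃ ζ ∈ Ioc (0 : ℝ) 1, ∀ u : Fin d → ℤ,
      ∀ X ∈ testFunctions I, (⨆ T ∈ Ioi (0 : ℝ), ENNReal.ofReal (1 / T) *
        ∫⁻ t in Ioc 0 T, ∫⁻ ω, moment (H ω) u σ ζ X t ∂P) < ∞) → CorrelatorDecay P H I := by
    rintro ⟨σ, hσ, ζ, hζ, h⟩
    -- The bound in (i) may depend on u, so only u = 0 is used and covariance does the rest; e^σ is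
    -- the cost of replacing points by box centres.
    refine ⟨ζ, hζ, σ, hσ, fun X hX => ⟨ENNReal.ofReal (Real.exp σ) * _,
      ENNReal.mul_ne_top ENNReal.ofReal_ne_top (h 0 X hX).ne, fun x u => ?_⟩⟩
    beta_reduce
    rw [hH.lintegral_correlator_sub hν]
    refine (lintegral_correlator_le hν hSA hres hpp hX hζ.1 hζ.2 hσ (x - u) 0).trans_eq ?_
    rw [sub_zero, mul_right_comm, ofReal_exp_mul_ofReal_exp]
    congr 3
    ring
  have three_of_decay : CorrelatorDecay P H I → ∃ σ > (0 : ℝ), ∃ ζ ∈ Ioc (0 : ℝ) 1,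
      ∀ u : Fin d → ℤ, ∀ X ∈ testFunctions I,
        ∫⁻ ω, ⨆ t : ℝ, moment (H ω) u σ ζ X t ∂P < ∞ := by
    rintro ⟨ζ, hζ, σ, hσ, h⟩
    -- The convolved fourth roots decay at rate σ/8; half compensates the weight of the moment and
    -- half makes the sum over x converge.
    refine ⟨σ / 16, by positivity, ζ, hζ, fun u X hX => ?_⟩
    obtain ⟨a, b, hs, C, hC, htb⟩ := htb X hX
    obtain ⟨M, hM, hXM⟩ := exists_bound_of_testFunction hX
    obtain ⟨K, hK, hKb⟩ := (h X hX).lintegral_tsum_correlator (hmeas X hX) hζ.1 hζ.2 hσ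
    have hc : M * C ^ 2 * C ^ 2 ≠ ∞ := by finiteness
    have h1 := (htb.and hpp).mono fun ω h2 =>
      iSup_moment_le hν (hSA ω) h2.2 hX h2.1 hs hXM hζ.1 hζ.2 (by positivity : 0 < σ / 16) u
    refine (lintegral_mono_ae h1).trans_lt ?_
    rw [lintegral_const_mul' _ _ hc, lintegral_tsum fun x =>
      (aemeasurable_tsum_correlator (hmeas X hX) x u).const_mul _]
    refine ENNReal.mul_lt_top hc.lt_top ?_
    have h4 : ∀ x : Fin d → ℤ, ∫⁻ ω, ENNReal.ofReal
        (Real.exp (σ / 16 * (‖latticePt (x - u)‖ ^ ζ + 1))) *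
        ∑' v, correlator (H ω) X x v ^ (1 / 4 : ℝ) * correlator (H ω) X v u ^ (1 / 4 : ℝ) ∂P ≤
        K * ENNReal.ofReal (Real.exp (σ / 16)) *
          ENNReal.ofReal (Real.exp (-(σ / 16) * ‖latticePt (x - u)‖ ^ ζ)) := by
      intro x
      rw [lintegral_const_mul' _ _ ENNReal.ofReal_ne_top]
      refine (mul_le_mul_right (hKb x u) _).trans_eq ?_
      rw [mul_left_comm, mul_assoc K, ofReal_exp_mul_ofReal_exp, ofReal_exp_mul_ofReal_exp]
      congr 3
      ring
    refine (ENNReal.tsum_le_tsum h4).trans_lt ?_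
    rw [ENNReal.tsum_mul_left, tsum_exp_neg_norm_rpow_const]
    exact ENNReal.mul_lt_top (ENNReal.mul_lt_top hK.lt_top ENNReal.ofReal_lt_top)
      (tsum_exp_neg_norm_rpow_lt_top (by positivity) hζ.1)
  tfae_have 1 → 3 := three_of_decay ∘ decay_of_one
  have four_of_decay : CorrelatorDecay P H I → ∃ ζ ∈ Ioc (0 : ℝ) 1, ∃ σ > (0 : ℝ),
      ∀ X ∈ testFunctions I, SubexpDecay (fun x u => ∫⁻ ω, ⨆ t : ℝ,
        hsNorm (chi ν x * evolution (H ω) X t * chi ν u) ∂P) ζ σ := by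
    rintro ⟨ζ, hζ, σ, hσ, h⟩
    refine ⟨ζ, hζ, σ / 8, by positivity, fun X hX => ?_⟩
    obtain ⟨a, b, hs, C, hC, htb⟩ := htb X hX
    refine ((h X hX).lintegral_tsum_correlator (hmeas X hX) hζ.1 hζ.2 hσ).mono
      (ENNReal.pow_ne_top hC (n := 2)) fun x u => ?_
    rw [← lintegral_const_mul' _ _ (ENNReal.pow_ne_top hC)]
    refine lintegral_mono_ae ?_
    filter_upwards [htb, hpp] with ω h2 h3 using iSup_evolution_le hν (hSA ω) h3 hX h2 hs x u
  tfae_have 1 → 4 := four_of_decay ∘ decay_of_one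
  tfae_have 4 → 5 := by
    rintro ⟨ζ, hζ, σ, hσ, h⟩
    refine ⟨ζ, hζ, σ, hσ, fun X hX => (h X hX).mono ENNReal.one_ne_top fun x u => ?_⟩
    rw [one_mul]
    refine lintegral_mono_ae ?_
    filter_upwards [hpp] with ω h3 using
      iSup_eigenKernel_le_iSup_evolution hν (hSA ω) h3 hX x u
  tfae_have 5 → 3 := by
    rintro ⟨ζ, hζ, σ, hσ, h⟩
    refine three_of_decay ⟨ζ, hζ, σ, hσ, fun X hX => ?_⟩
    obtain ⟨a, b, hs, C, hC, htb⟩ := htb X hX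
    obtain ⟨M, hM, hXM⟩ := exists_bound_of_testFunction hX
    have hc : M * C ^ 2 ≠ ∞ := by finiteness
    refine (h X hX).mono hc fun x u => ?_
    rw [← lintegral_const_mul' _ _ hc]
    refine lintegral_mono_ae ?_
    filter_upwards [htb] with ω h2 using h2.correlator_le hs hXM x u
  tfae_finish
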